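/- **Deep neural network estimation error upper bound.** Let $d,N,L\ge 1$ be integers (if $L=1$ there is no hidden layer, and then $N=1$ is required), and let $\sigma^2>0$. Put $d_0=d$, $d_\ell=N$ for $1\le \ell\le L-1$, and $d_L=1$. Let $\theta=(A^{(1)},\dots,A^{(L)})$ be independent random matrices, $A^{(\ell)}\in\mathbb R^{d_\ell\times d_{\ell-1}}$ having i.i.d. $\mathcal N(0,1/d_{\ell-1})$ entries. Let $X_0,X_1,\dots$ be i.i.d. $\mathcal N(0,I_d)$ and $W_1,W_2,\dots$ be i.i.d. $\mathcal N(0,\sigma^2)$, with $\theta$, $(X_t)_{t\ge 0}$, $(W_t)_{t\ge 1}$ independent. For $t\ge0$ let $$U_t^{(0)}=X_t,\qquad U_t^{(\ell+1)}=\mathrm{ReLU}\big(A^{(\ell+1)}U_t^{(\ell)}\big)\quad(0\le \ell<L),\qquad Y_{t+1}=U_t^{(L)}+W_{t+1}.$$ Let $H_t=(X_0,Y_1,\dots,X_{t-1},Y_t,X_t)$, and let $\hat P_t=\mathbb P(Y_{t+1}\in\cdot\mid H_t)$ be the Bayesian posterior predictive distribution, with density $\hat p_t$ with respect to Lebesgue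 measure. For $T\ge1$ define the estimation error $$\mathcal L_T=\frac1T\sum_{t=0}^{T-1}\mathbb E\big[-\ln \hat p_t(Y_{t+1})\big]-\frac{\mathbf h(Y_{1:T}\mid\theta,X_{0:T-1})}{T},$$ where $\mathbf h(V\mid Z)=\mathbb E[-\ln p(V\mid Z)]$ is the conditional differential entropy. Then, for all $T\ge 1$, the densities in this formula exist almost surely, all the expectations in it are those of integrable random variables, and $$\mathcal L_T\ \le\ \frac{P}{2T}\left(1+\ln\left(1+\frac{2LT}{\sigma^2P}\right)\right),\qquad P=(L-2)N^2+N+dN,$$ where $P$ is the total parameter count of the network. -/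

import Mathlib

open MeasureTheory ProbabilityTheory
open scoped NNReal ENNReal

noncomputable section

namespace BayesDNN

/-! ### Log-loss and estimation error of the Bayesian posterior -/

section Framework

variable {Ω Θ 𝒳 α β : Type*} [MeasurableSpace Ω] [MeasurableSpace Θ] [MeasurableSpace 𝒳]
  [MeasurableSpace α] [MeasureSpace β]

/-- The density `p(b | a)` of a probability kernel `κ` with respect to the reference measure
`volume`, as a jointly measurable function of `(a, b)`: the Radon-Nikodym derivative of the joint
law `ν ⊗ₘ κ` with respect to `ν × volume`.  When `κ a ≪ volume` for `ν`-almost every `a`, it is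
the function (unique almost everywhere) for which `κ a` has density `p(· | a)`. -/
def kernelDensity (ν : Measure α) (κ : Kernel α β) : α × β → ℝ≥0∞ :=
  (ν ⊗ₘ κ).rnDeriv (ν.prod volume)

/-- The log-loss `-ln P(V)` suffered on the label `V` when it is predicted by the distribution
`P = κ Z`, where `P(V)` is the value at `V` of the density of `P`. -/
def logLoss (μ : Measure Ω) (Z : Ω → α) (V : Ω → β) (κ : Kernel α β) (ω : Ω) : ℝ :=
  -Real.log (kernelDensity (μ.map Z) κ (Z ω, V ω)).toReal

/-- The log-loss of the predictor `κ` makes sense and has a finite expectation: the predictive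
distribution almost surely has a density and the log-loss is integrable. -/
def HasFiniteLogLoss (μ : Measure Ω) (Z : Ω → α) (V : Ω → β) (κ : Kernel α β) : Prop :=
  (∀ᵐ z ∂(μ.map Z), κ z ≪ volume) ∧ Integrable (logLoss μ Z V κ) μ

variable [StandardBorelSpace β] [Nonempty β]

/-- The conditional differential entropy `h(V | Z) = 𝔼[-ln p(V | Z)]`. -/
def condDiffEntropy (μ : Measure Ω) [IsFiniteMeasure μ] (V : Ω → β) (Z : Ω → α) : ℝ :=
  ∫ ω, logLoss μ Z V (condDistrib V Z μ) ω ∂μ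

/-- The history `H_t = (X_0, Y_1, …, X_{t-1}, Y_t, X_t)`.  Here and below `Y t` is the label
`Y_{t+1}` that belongs to the input `X_t = X t`. -/
def history (X : ℕ → Ω → 𝒳) (Y : ℕ → Ω → β) (t : ℕ) (ω : Ω) :
    (Fin (t + 1) → 𝒳) × (Fin t → β) :=
  (fun s => X s ω, fun s => Y s ω)

/-- The Bayesian posterior predictive distribution `P̂_t = ℙ(Y_{t+1} ∈ · | H_t)`. -/
def posteriorPredictive (μ : Measure Ω) [IsFiniteMeasure μ] (X : ℕ → Ω → 𝒳) (Y : ℕ → Ω → β)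
    (t : ℕ) : Kernel ((Fin (t + 1) → 𝒳) × (Fin t → β)) β :=
  condDistrib (Y t) (history X Y t) μ

/-- The labels `Y_{1:T}`. -/
def labels (Y : ℕ → Ω → β) (T : ℕ) (ω : Ω) : Fin T → β := fun s => Y s ω

/-- The latent variable together with the inputs, `(θ, X_{0:T-1})`. -/
def latentInputs (θ : Ω → Θ) (X : ℕ → Ω → 𝒳) (T : ℕ) (ω : Ω) : Θ × (Fin T → 𝒳) :=
  (θ ω, fun s => X s ω)

/-- The estimation error of the Bayesian posterior,
`𝓛_T = (1/T) ∑_{t<T} 𝔼[-ln P̂_t(Y_{t+1})] - h(Y_{1:T} | θ, X_{0:T-1}) / T`. -/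
def estimationError (μ : Measure Ω) [IsFiniteMeasure μ] (θ : Ω → Θ) (X : ℕ → Ω → 𝒳)
    (Y : ℕ → Ω → ℝ) (T : ℕ) : ℝ :=
  (1 / (T : ℝ)) * ∑ t ∈ Finset.range T,
      ∫ ω, logLoss μ (history X Y t) (Y t) (posteriorPredictive μ X Y t) ω ∂μ
    - condDiffEntropy μ (labels Y T) (latentInputs θ X T) / (T : ℝ)

end Framework

/-! ### The deep neural network process -/

/-- The dimension of the output `U^(ℓ)` of layer `ℓ`: the input has dimension `d`, the hidden
layers have width `N`, the last layer has dimension `1`. -/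
def layerDim (d N L : ℕ) : ℕ → ℕ
  | 0 => d
  | ℓ + 1 => if ℓ + 1 = L then 1 else N

theorem layerDim_last (d N : ℕ) {L : ℕ} (hL : 1 ≤ L) : layerDim d N L L = 1 := by
  obtain ⟨k, rfl⟩ : ∃ k, L = k + 1 := ⟨L - 1, by omega⟩
  simp [layerDim]

/-- The weights `(A^(1), …, A^(L))`; `A ℓ` is the matrix `A^(ℓ+1)`, with entries
`A ℓ i j`, for `ℓ = 0, …, L - 1`. -/
abbrev Weights (d N L : ℕ) : Type :=
  (ℓ : Fin L) → Fin (layerDim d N L (ℓ + 1)) → Fin (layerDim d N L ℓ) → ℝ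

/-- The prior: layers are independent and the entries of a layer with input dimension `m` are
independent with law `𝒩(0, 1/m)`. -/
def prior (d N L : ℕ) : Measure (Weights d N L) :=
  Measure.pi fun ℓ : Fin L => Measure.pi fun _ => Measure.pi fun _ =>
    gaussianReal 0 ((layerDim d N L ℓ : ℝ≥0)⁻¹)

/-- The layer outputs `U^(0) = x`, `U^(ℓ+1) = ReLU (A^(ℓ+1) U^(ℓ))`. -/
def layerOutput {d N L : ℕ} (A : Weights d N L) (x : Fin d → ℝ) :
    (ℓ : ℕ) → ℓ ≤ L → (Fin (layerDim d N L ℓ) → ℝ)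
  | 0, _ => x
  | ℓ + 1, h => fun i =>
      max 0 (∑ j, A ⟨ℓ, h⟩ i j * layerOutput A x ℓ (Nat.le_of_succ_le h) j)

/-- The scalar network output `U^(L)`. -/
def networkOutput {d N L : ℕ} (hL : 1 ≤ L) (A : Weights d N L) (x : Fin d → ℝ) : ℝ :=
  layerOutput A x L le_rfl (Fin.cast (layerDim_last d N hL).symm 0)

/-- `(X_t, Y_{t+1})`, `t = 0, 1, …`, are generated by the deep neural network process with input
dimension `d`, width `N`, depth `L`, random weights `A` and output noise `W` of variance `v`;
`Y t` and `W t` are `Y_{t+1}` and `W_{t+1}`. -/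
structure IsDNNProcess {Ω : Type*} [MeasurableSpace Ω] (μ : Measure Ω) {d N L : ℕ} (hL : 1 ≤ L)
    (v : ℝ≥0) (A : Ω → Weights d N L) (X : ℕ → Ω → (Fin d → ℝ)) (W Y : ℕ → Ω → ℝ) : Prop where
  measurable_weights : Measurable A
  measurable_input : ∀ t, Measurable (X t)
  measurable_noise : ∀ t, Measurable (W t)
  law_weights : μ.map A = prior d N L
  law_input : ∀ t, μ.map (X t) = Measure.pi fun _ => gaussianReal 0 1
  law_noise : ∀ t, μ.map (W t) = gaussianReal 0 v
  indep_input : iIndepFun X μ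
  indep_noise : iIndepFun W μ
  indep_input_noise : IndepFun (fun ω t => X t ω) (fun ω t => W t ω) μ
  indep_weights : IndepFun A (fun ω => (fun t => X t ω, fun t => W t ω)) μ
  label_eq : ∀ t ω, Y t ω = networkOutput hL (A ω) (X t ω) + W t ω

/-- The parameter count `P = (L - 2) N² + N + d N`. -/
def paramCount (d N L : ℕ) : ℝ := ((L : ℝ) - 2) * (N : ℝ) ^ 2 + N + d * N

end BayesDNN

end

noncomputable section

set_option linter.unusedSectionVars false

namespace BayesDNN

/-! ### Product measures with densities -/

section MeasureTools

/-! Let M_n be the marginal likelihood of the first n labels given the inputs, that is, the Gaussian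
likelihood averaged over the prior. The posterior predictive density at time t is M_{t+1}/M_t, so
the log-losses telescope to -ln M_T. Given the weights and inputs only the noise is random, so the
entropy term is T(ln √(2πσ²) + 1/2) (`estimationError_eq`). It remains to bound E[-ln M_T] from
above.

The bound is variational. For each value a of the true weights, the prior is written as the law of a
noisy copy r a + e, reweighted by a density exp(-q(a, e)) (`weightLaw_eq_map_withDensity`). Then M_T
is an exponential moment over the noise e alone, and Jensen (`neg_log_lintegral_exp_le`) moves the
logarithm inside. After averaging, the noise energy cancels the entropy, and two terms remain
(`estimationError_le`): the mean squared output change divided by 2σ², and E[q]/T.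

The noisy copy has r² + s = 1, and the variance of e is s times the prior variance, so r a + e again
has the prior law. Hence E[q] is the mutual information between weights and noisy copy, -(ln s)/2
per entry (`entryCost_integrable`). Both networks therefore keep the same bound on their second
moments in every layer. ReLU is 1-Lipschitz and each layer adds relative error at most 2s, so the
output distortion is at most 2sL (`network_moments`, `network_distortion`). The choice s = 1/(1 +
2LT/(σ²P)) balances the two terms. -/

theorem lintegral_pi_prod {ι : Type*} [Fintype ι] {α : ι → Type*} [∀ i, MeasurableSpace (α i)]
    (ν : ∀ i, Measure (α i)) [∀ i, IsProbabilityMeasure (ν i)] {f : ∀ i, α i → ℝ≥0∞}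
    (hf : ∀ i, Measurable (f i)) :
    ∫⁻ x, ∏ i, f i (x i) ∂(Measure.pi ν) = ∏ i, ∫⁻ x, f i x ∂(ν i) := by
  have hind : iIndepFun (fun i (x : ∀ i, α i) => f i (x i)) (Measure.pi ν) :=
    iIndepFun_pi fun i => (hf i).aemeasurable
  rw [lintegral_prod_eq_prod_lintegral_of_indepFun Finset.univ _ hind
    fun i => (hf i).comp (measurable_pi_apply i)]
  exact Finset.prod_congr rfl fun i _ =>
    (measurePreserving_eval ν i).lintegral_comp (hf i)

theorem pi_withDensity {ι : Type*} [Fintype ι] {α : ι → Type*} [∀ i, MeasurableSpace (α i)]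
    (ν : ∀ i, Measure (α i)) [∀ i, IsProbabilityMeasure (ν i)] {f : ∀ i, α i → ℝ≥0∞}
    (hf : ∀ i, Measurable (f i)) [∀ i, SigmaFinite ((ν i).withDensity (f i))] :
    Measure.pi (fun i => (ν i).withDensity (f i)) =
      (Measure.pi ν).withDensity fun x => ∏ i, f i (x i) := by
  refine Measure.pi_eq fun s hs => ?_
  rw [withDensity_apply _ (MeasurableSet.univ_pi hs), ← lintegral_indicator (.univ_pi hs)]
  have h : ∀ x : ∀ i, α i, (Set.univ.pi s).indicator (fun x => ∏ i, f i (x i)) x =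
      ∏ i, (s i).indicator (f i) (x i) := by
    intro x
    by_cases hx : x ∈ Set.univ.pi s
    · rw [Set.indicator_of_mem hx]
      exact Finset.prod_congr rfl fun i _ => by rw [Set.indicator_of_mem (hx i trivial)]
    · rw [Set.indicator_of_notMem hx]
      obtain ⟨i, hi⟩ : ∃ i, x i ∉ s i := by simpa using hx
      exact (Finset.prod_eq_zero (Finset.mem_univ i) (Set.indicator_of_notMem hi _)).symm
  simp_rw [h]
  rw [lintegral_pi_prod ν fun i => (hf i).indicator (hs i)]
  exact Finset.prod_congr rfl fun i _ => by
    rw [lintegral_indicator (hs i), withDensity_apply _ (hs i)]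

theorem map_withDensity_comp {α β : Type*} [MeasurableSpace α] [MeasurableSpace β]
    {μ : Measure α} {e : α → β} (he : Measurable e) {g : β → ℝ≥0∞} (hg : Measurable g) :
    (μ.withDensity fun x => g (e x)).map e = (μ.map e).withDensity g := by
  ext s hs
  rw [Measure.map_apply he hs, withDensity_apply _ hs, withDensity_apply _ (he hs),
    setLIntegral_map hs hg he]

theorem map_snd_withDensity {α β : Type*} [MeasurableSpace α] [MeasurableSpace β]
    {μ : Measure α} {ν : Measure β} [SFinite μ] [SFinite ν] {g : α × β → ℝ≥0∞}
    (hg : Measurable g) :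
    ((μ.prod ν).withDensity g).map Prod.snd = ν.withDensity fun b => ∫⁻ a, g (a, b) ∂μ := by
  ext s hs
  rw [Measure.map_apply measurable_snd hs, withDensity_apply _ hs,
    withDensity_apply _ (measurable_snd hs), ← Set.univ_prod, ← Measure.prod_restrict,
    Measure.restrict_univ, lintegral_prod_symm' _ hg]

/-- The law of a vector of independent Gaussian variables has the product density. -/
theorem pi_gaussianReal {ι : Type*} [Fintype ι] {v : ℝ≥0} (hv : v ≠ 0) :
    Measure.pi (fun _ : ι => gaussianReal 0 v) =
      (volume : Measure (ι → ℝ)).withDensity fun x => ∏ i, gaussianPDF 0 v (x i) := by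
  have hm := measurable_gaussianPDF 0 v
  -- `pi_withDensity` takes probability measures as base, which Lebesgue measure is not. Lebesgue
  -- measure is therefore written with the inverse density over the Gaussian, multiplied up
  -- coordinatewise, and the density is inverted at the end.
  have h1 : (volume : Measure ℝ) =
      (gaussianReal 0 v).withDensity fun x => (gaussianPDF 0 v x)⁻¹ := by
    rw [gaussianReal_of_var_ne_zero 0 hv]
    exact (withDensity_inv_same hm (Filter.Eventually.of_forall fun x =>
      (gaussianPDF_pos 0 hv x).ne') (Filter.Eventually.of_forall fun x =>
      gaussianPDF_ne_top)).symm
  have hsf : SigmaFinite ((gaussianReal 0 v).withDensity fun x => (gaussianPDF 0 v x)⁻¹) := by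
    rw [← h1]; infer_instance
  have h2 : (volume : Measure (ι → ℝ)) = (Measure.pi fun _ : ι => gaussianReal 0 v).withDensity
      fun x => ∏ i, (gaussianPDF 0 v (x i))⁻¹ := by
    rw [volume_pi]
    conv_lhs => rw [h1]
    exact pi_withDensity (fun _ => gaussianReal 0 v) fun _ => hm.inv
  rw [h2, ← withDensity_mul _ (by fun_prop) (by fun_prop)]
  have h3 : ((fun x : ι → ℝ => ∏ i, (gaussianPDF 0 v (x i))⁻¹) *
      fun x => ∏ i, gaussianPDF 0 v (x i)) = 1 := by
    ext x
    simp only [Pi.mul_apply, Pi.one_apply]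
    rw [← Finset.prod_mul_distrib]
    exact Finset.prod_eq_one fun i _ =>
      ENNReal.inv_mul_cancel (gaussianPDF_pos 0 hv _).ne' gaussianPDF_ne_top
  rw [h3, withDensity_one]

/-- The law of `(e, F e + w)`, where `e` has law `ν` and `w` is independent Gaussian noise. -/
theorem map_add_gaussian_noise {E ι : Type*} [MeasurableSpace E] [Fintype ι] (ν : Measure E)
    [SFinite ν] {v : ℝ≥0} (hv : v ≠ 0) {F : E → ι → ℝ} (hF : Measurable F) :
    (ν.prod (Measure.pi fun _ : ι => gaussianReal 0 v)).map (fun p => (p.1, F p.1 + p.2)) =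
      (ν.prod volume).withDensity fun p : E × (ι → ℝ) => ∏ i, gaussianPDF (F p.1 i) v (p.2 i) := by
  -- The shear by `F` preserves `ν × volume` by translation invariance, so the noise density is just
  -- transported along it.
  have hmp : MeasurePreserving (fun p : E × (ι → ℝ) => (p.1, F p.1 + p.2))
      (ν.prod volume) (ν.prod volume) :=
    (MeasurePreserving.id ν).skew_product (g := fun a c => F a + c) (by fun_prop)
      (Filter.Eventually.of_forall fun a => map_add_left_eq_self _ _)
  have hm : Measurable fun p : E × (ι → ℝ) => ∏ i, gaussianPDF (F p.1 i) v (p.2 i) := by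
    refine Finset.measurable_prod _ fun i _ => ?_
    exact measurable_uncurry_gaussianPDF.comp
      (((measurable_pi_apply i).comp (hF.comp measurable_fst)).prodMk
        (measurable_const.prodMk ((measurable_pi_apply i).comp measurable_snd)))
  have hg : Measurable fun x : ι → ℝ => ∏ i, gaussianPDF 0 v (x i) :=
    Finset.measurable_prod _ fun i _ =>
      (measurable_gaussianPDF 0 v).comp (measurable_pi_apply i)
  have : SFinite ((volume : Measure (ι → ℝ)).withDensity
      fun x => ∏ i, gaussianPDF 0 v (x i)) := by
    rw [← pi_gaussianReal hv]; infer_instance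
  rw [pi_gaussianReal hv, prod_withDensity_right hg]
  conv_rhs => rw [← hmp.map_eq]
  rw [← map_withDensity_comp hmp.measurable hm]
  congr 2
  ext p
  refine Finset.prod_congr rfl fun i _ => ?_
  simp [gaussianPDF, gaussianPDFReal]

theorem measurable_update_uncurry {ι : Type*} [DecidableEq ι] {α : ι → Type*}
    [∀ i, MeasurableSpace (α i)] (i : ι) :
    Measurable fun p : (∀ i, α i) × α i => Function.update p.1 i p.2 := by
  refine measurable_pi_lambda _ fun j => ?_
  by_cases h : j = i
  · subst h; simpa using measurable_snd
  · simp only [Function.update_of_ne h]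
    fun_prop

/-- Resampling one coordinate does not change a product measure. -/
theorem lintegral_pi_update {ι : Type*} [Fintype ι] [DecidableEq ι] {α : ι → Type*}
    [∀ i, MeasurableSpace (α i)] (ν : ∀ i, Measure (α i)) [∀ i, IsProbabilityMeasure (ν i)]
    (i : ι) {F : (∀ i, α i) → ℝ≥0∞} (hF : Measurable F) :
    ∫⁻ x, F x ∂(Measure.pi ν) =
      ∫⁻ x, ∫⁻ b, F (Function.update x i b) ∂(ν i) ∂(Measure.pi ν) := by
  have hu := measurable_update_uncurry (α := α) i
  have hmap : ((Measure.pi ν).prod (ν i)).map (fun p => Function.update p.1 i p.2) =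
      Measure.pi ν := by
    symm
    refine Measure.pi_eq fun s hs => ?_
    rw [Measure.map_apply hu (.univ_pi hs)]
    have : (fun p : (∀ i, α i) × α i => Function.update p.1 i p.2) ⁻¹' (Set.univ.pi s) =
        (Set.univ.pi (Function.update s i Set.univ)) ×ˢ s i := by
      ext p
      simp only [Set.mem_preimage, Set.mem_pi, Set.mem_univ, true_implies, Set.mem_prod]
      constructor
      · intro h
        refine ⟨fun j => ?_, by simpa using h i⟩
        by_cases hj : j = i
        · subst hj; simp
        · simpa [hj] using h j
      · rintro ⟨h1, h2⟩ j
        by_cases hj : j = i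
        · subst hj; simpa using h2
        · simpa [hj] using h1 j
    rw [this, Measure.prod_prod, Measure.pi_pi, ← Finset.mul_prod_erase _ _ (Finset.mem_univ i),
      ← Finset.mul_prod_erase _ (fun j => ν j (s j)) (Finset.mem_univ i)]
    simp only [Function.update_self, measure_univ, one_mul]
    rw [mul_comm]
    congr 1
    refine Finset.prod_congr rfl fun j hj => ?_
    rw [Function.update_of_ne (Finset.ne_of_mem_erase hj)]
  conv_lhs => rw [← hmap]
  rw [lintegral_map hF hu, lintegral_prod (fun p => F (Function.update p.1 i p.2)) (hF.comp hu).aemeasurable]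

end MeasureTools

/-! ### Densities of kernels -/

section KernelDensity

variable {Ω α β : Type*} [MeasurableSpace Ω] [MeasurableSpace α] [MeasureSpace β]
  [StandardBorelSpace β] [Nonempty β] [SigmaFinite (volume : Measure β)]

/-- A conditional density is the joint density divided by the marginal one. Since `g` is never 0 or
∞, dividing by it passes from the base `lam × volume` to the base `law(Z) × volume` used by
`kernelDensity`. -/
theorem kernelDensity_condDistrib {μ : Measure Ω} [IsProbabilityMeasure μ] {Z : Ω → α} {V : Ω → β}
    (hZ : Measurable Z) (hV : Measurable V) {lam : Measure α} [SigmaFinite lam] {g : α → ℝ≥0∞}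
    {h : α × β → ℝ≥0∞} (hg : Measurable g) (hh : Measurable h) (hg0 : ∀ z, g z ≠ 0)
    (hgt : ∀ z, g z ≠ ∞) (hlawZ : μ.map Z = lam.withDensity g)
    (hlaw : μ.map (fun ω => (Z ω, V ω)) = (lam.prod volume).withDensity h) :
    (∀ᵐ z ∂(μ.map Z), condDistrib V Z μ z ≪ volume) ∧
      ∀ᵐ ω ∂μ, kernelDensity (μ.map Z) (condDistrib V Z μ) (Z ω, V ω) =
        h (Z ω, V ω) / g (Z ω) := by
  have : IsProbabilityMeasure (μ.map Z) := Measure.isProbabilityMeasure_map hZ.aemeasurable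
  have hjoint : (μ.map Z) ⊗ₘ condDistrib V Z μ = μ.map (fun ω => (Z ω, V ω)) :=
    compProd_map_condDistrib hV.aemeasurable
  have hq : Measurable fun p : α × β => h p / g p.1 := hh.div (hg.comp measurable_fst)
  have hdens : (μ.map Z) ⊗ₘ condDistrib V Z μ =
      ((μ.map Z).prod volume).withDensity fun p => h p / g p.1 := by
    have : SFinite (lam.withDensity g) := by rw [← hlawZ]; infer_instance
    have hg' : Measurable fun p : α × β => g p.1 := hg.comp measurable_fst
    rw [hjoint, hlaw, hlawZ, prod_withDensity_left hg, ← withDensity_mul _ hg' hq]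
    congr 1
    ext p
    simp only [Pi.mul_apply]
    rw [ENNReal.mul_div_cancel (hg0 _) (hgt _)]
  have hac : (μ.map Z) ⊗ₘ condDistrib V Z μ ≪ (μ.map Z).prod volume := by
    rw [hdens]; exact withDensity_absolutelyContinuous _ _
  constructor
  -- Lebesgue-type `volume` is replaced by an equivalent finite measure so that absolute continuity
  -- of the joint laws can be disintegrated into that of the kernels.
  · have : (μ.map Z) ⊗ₘ condDistrib V Z μ ≪
        (μ.map Z) ⊗ₘ Kernel.const α (volume : Measure β).toFinite := by
      rw [Measure.compProd_const]
      exact hac.trans (Measure.AbsolutelyContinuous.rfl.prod (absolutelyContinuous_toFinite _))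
    filter_upwards [this.kernel_of_compProd] with z hz
    rw [Kernel.const_apply] at hz
    exact hz.trans (toFinite_absolutelyContinuous _)
  · have h1 : kernelDensity (μ.map Z) (condDistrib V Z μ) =ᵐ[(μ.map Z).prod volume]
        fun p => h p / g p.1 := by
      unfold kernelDensity
      rw [hdens]
      exact Measure.rnDeriv_withDensity _ hq
    have h2 := hac.ae_eq h1
    rw [hjoint] at h2
    exact ae_of_ae_map (hZ.prodMk hV).aemeasurable h2

theorem logLoss_condDistrib {μ : Measure Ω} [IsProbabilityMeasure μ] {Z : Ω → α} {V : Ω → β}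
    (hZ : Measurable Z) (hV : Measurable V) {lam : Measure α} [SigmaFinite lam] {g : α → ℝ≥0∞}
    {h : α × β → ℝ≥0∞} (hg : Measurable g) (hh : Measurable h) (hg0 : ∀ z, g z ≠ 0)
    (hgt : ∀ z, g z ≠ ∞) (hh0 : ∀ z, h z ≠ 0) (hht : ∀ z, h z ≠ ∞)
    (hlawZ : μ.map Z = lam.withDensity g)
    (hlaw : μ.map (fun ω => (Z ω, V ω)) = (lam.prod volume).withDensity h) :
    logLoss μ Z V (condDistrib V Z μ) =ᵐ[μ]
      fun ω => Real.log (g (Z ω)).toReal - Real.log (h (Z ω, V ω)).toReal := by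
  filter_upwards [(kernelDensity_condDistrib hZ hV hg hh hg0 hgt hlawZ hlaw).2] with ω hω
  rw [logLoss, hω, ENNReal.toReal_div, Real.log_div (ENNReal.toReal_ne_zero.2 ⟨hh0 _, hht _⟩)
    (ENNReal.toReal_ne_zero.2 ⟨hg0 _, hgt _⟩)]
  ring

end KernelDensity

/-! ### Bayesian regression with Gaussian noise -/

section Regression

variable {Ω Θ 𝒳 : Type*} [MeasurableSpace Ω] [MeasurableSpace Θ] [MeasurableSpace 𝒳]

/-- The labels are `Y t = f (θ, X t) + W t` with prior law `π` of `θ`, inputs of law `γ` and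
Gaussian noise of variance `v`. -/
structure IsGaussianRegression (μ : Measure Ω) (π : Measure Θ) (γ : Measure 𝒳)
    (f : Θ × 𝒳 → ℝ) (v : ℝ≥0) (θ : Ω → Θ) (X : ℕ → Ω → 𝒳) (W Y : ℕ → Ω → ℝ) : Prop where
  measurable_latent : Measurable θ
  measurable_input : ∀ t, Measurable (X t)
  measurable_noise : ∀ t, Measurable (W t)
  measurable_fun : Measurable f
  label_eq : ∀ t ω, Y t ω = f (θ ω, X t ω) + W t ω
  law_joint : ∀ n m : ℕ,
    μ.map (fun ω => ((θ ω, fun s : Fin n => X s ω), fun s : Fin m => W s ω)) =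
      (π.prod (Measure.pi fun _ => γ)).prod (Measure.pi fun _ => gaussianReal 0 v)
  law_latent_input : ∀ t, μ.map (fun ω => (θ ω, X t ω)) = π.prod γ
  law_noise : ∀ t, μ.map (W t) = gaussianReal 0 v
  indep_noise : ∀ t, IndepFun (fun ω => (θ ω, X t ω)) (W t) μ

/-- The likelihood of the labels `p.2` for the inputs `p.1` under the latent variable `θ`. -/
def likelihood (f : Θ × 𝒳 → ℝ) (v : ℝ≥0) (n : ℕ) (θ : Θ) (p : (Fin n → 𝒳) × (Fin n → ℝ)) :
    ℝ≥0∞ :=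
  ∏ s, gaussianPDF (f (θ, p.1 s)) v (p.2 s)

/-- The likelihood averaged over the prior. -/
def marginalLikelihood (π : Measure Θ) (f : Θ × 𝒳 → ℝ) (v : ℝ≥0) (n : ℕ)
    (p : (Fin n → 𝒳) × (Fin n → ℝ)) : ℝ≥0∞ :=
  ∫⁻ θ, likelihood f v n θ p ∂π

theorem measurable_likelihood {f : Θ × 𝒳 → ℝ} (hf : Measurable f) (v : ℝ≥0) (n : ℕ) :
    Measurable fun p : Θ × ((Fin n → 𝒳) × (Fin n → ℝ)) => likelihood f v n p.1 p.2 := by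
  refine Finset.measurable_prod _ fun i _ => ?_
  refine measurable_uncurry_gaussianPDF.comp (Measurable.prodMk ?_ (measurable_const.prodMk ?_))
  · exact hf.comp (f := fun p : Θ × ((Fin n → 𝒳) × (Fin n → ℝ)) => (p.1, p.2.1 i)) (by fun_prop)
  · fun_prop

theorem measurable_marginalLikelihood (π : Measure Θ) [SFinite π] {f : Θ × 𝒳 → ℝ}
    (hf : Measurable f) (v : ℝ≥0) (n : ℕ) : Measurable (marginalLikelihood π f v n) :=
  (measurable_likelihood hf v n).lintegral_prod_left'

theorem likelihood_ne_zero (f : Θ × 𝒳 → ℝ) {v : ℝ≥0} (hv : v ≠ 0) {n : ℕ} (θ : Θ)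
    (p : (Fin n → 𝒳) × (Fin n → ℝ)) : likelihood f v n θ p ≠ 0 :=
  Finset.prod_ne_zero_iff.2 fun _ _ => (gaussianPDF_pos _ hv _).ne'

theorem likelihood_ne_top (f : Θ × 𝒳 → ℝ) (v : ℝ≥0) {n : ℕ} (θ : Θ)
    (p : (Fin n → 𝒳) × (Fin n → ℝ)) : likelihood f v n θ p ≠ ∞ :=
  ENNReal.prod_ne_top fun _ _ => gaussianPDF_ne_top

theorem gaussianPDF_eq_exp (m : ℝ) {v : ℝ≥0} (hv : v ≠ 0) (y : ℝ) :
    gaussianPDF m v y =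
      ENNReal.ofReal (Real.exp (-(Real.log √(2 * Real.pi * v) + (y - m) ^ 2 / (2 * v)))) := by
  have h : 0 < √(2 * Real.pi * v) := by
    have : (0 : ℝ) < v := by positivity
    positivity
  rw [gaussianPDF, gaussianPDFReal, neg_add, Real.exp_add, Real.exp_neg (Real.log _),
    Real.exp_log h, neg_div]

theorem likelihood_eq_exp (f : Θ × 𝒳 → ℝ) {v : ℝ≥0} (hv : v ≠ 0) {n : ℕ} (θ : Θ)
    (p : (Fin n → 𝒳) × (Fin n → ℝ)) :
    likelihood f v n θ p = ENNReal.ofReal (Real.exp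
      (-∑ s, (Real.log √(2 * Real.pi * v) + (p.2 s - f (θ, p.1 s)) ^ 2 / (2 * v)))) := by
  simp only [likelihood, gaussianPDF_eq_exp _ hv]
  rw [← Finset.sum_neg_distrib, Real.exp_sum,
    ENNReal.ofReal_prod_of_nonneg fun _ _ => (Real.exp_pos _).le]

/-- Each Gaussian factor is at most its peak value. The bound is uniform in the latent variable, so
it passes to the marginal likelihood, gives its finiteness, and later bounds the negative
log-evidence from below. -/
theorem likelihood_le (f : Θ × 𝒳 → ℝ) {v : ℝ≥0} (hv : v ≠ 0) {n : ℕ} (θ : Θ)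
    (p : (Fin n → 𝒳) × (Fin n → ℝ)) :
    likelihood f v n θ p ≤
      ENNReal.ofReal (Real.exp (-(n * Real.log √(2 * Real.pi * v)))) := by
  rw [likelihood_eq_exp f hv]
  refine ENNReal.ofReal_le_ofReal (Real.exp_le_exp.2 (neg_le_neg ?_))
  rw [Finset.sum_add_distrib, Finset.sum_const, Finset.card_univ, Fintype.card_fin, nsmul_eq_mul]
  have : 0 ≤ ∑ s, (p.2 s - f (θ, p.1 s)) ^ 2 / (2 * (v : ℝ)) :=
    Finset.sum_nonneg fun _ _ => by positivity
  linarith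

variable {π : Measure Θ} [IsProbabilityMeasure π]

theorem marginalLikelihood_le (f : Θ × 𝒳 → ℝ) {v : ℝ≥0} (hv : v ≠ 0) {n : ℕ}
    (p : (Fin n → 𝒳) × (Fin n → ℝ)) :
    marginalLikelihood π f v n p ≤
      ENNReal.ofReal (Real.exp (-(n * Real.log √(2 * Real.pi * v)))) := by
  refine (lintegral_mono fun θ => likelihood_le f hv θ p).trans ?_
  simp

theorem marginalLikelihood_ne_top (f : Θ × 𝒳 → ℝ) {v : ℝ≥0} (hv : v ≠ 0) {n : ℕ}
    (p : (Fin n → 𝒳) × (Fin n → ℝ)) : marginalLikelihood π f v n p ≠ ∞ :=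
  ne_top_of_le_ne_top ENNReal.ofReal_ne_top (marginalLikelihood_le f hv p)

theorem marginalLikelihood_ne_zero {f : Θ × 𝒳 → ℝ} (hf : Measurable f) {v : ℝ≥0} (hv : v ≠ 0)
    {n : ℕ} (p : (Fin n → 𝒳) × (Fin n → ℝ)) : marginalLikelihood π f v n p ≠ 0 := by
  have hm : Measurable fun θ => likelihood f v n θ p :=
    (measurable_likelihood hf v n).comp (f := fun θ => (θ, p)) (by fun_prop)
  intro h
  rw [marginalLikelihood, lintegral_eq_zero_iff hm] at h
  obtain ⟨θ, hθ⟩ := h.exists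
  exact likelihood_ne_zero f hv θ p hθ

/-- Splitting off the last label. -/
def splitLast (t : ℕ) : (Fin (t + 1) → ℝ) ≃ᵐ (Fin t → ℝ) × ℝ :=
  (MeasurableEquiv.piFinSuccAbove (fun _ => ℝ) (Fin.last t)).trans MeasurableEquiv.prodComm

theorem splitLast_apply (t : ℕ) (y : Fin (t + 1) → ℝ) :
    splitLast t y = (fun s => y s.castSucc, y (Fin.last t)) := by
  refine Prod.ext (funext fun s => ?_) rfl
  change y ((Fin.last t).succAbove s) = _
  rw [Fin.succAbove_last]

theorem measurePreserving_splitLast (t : ℕ) :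
    MeasurePreserving (splitLast t) volume (volume.prod volume) :=
  Measure.measurePreserving_swap.comp
    (volume_preserving_piFinSuccAbove (fun _ => ℝ) (Fin.last t))

/-- The logarithm of the marginal likelihood of the first `n` observations. -/
def logEvidence (π : Measure Θ) (f : Θ × 𝒳 → ℝ) (v : ℝ≥0) (X : ℕ → Ω → 𝒳) (Y : ℕ → Ω → ℝ)
    (n : ℕ) (ω : Ω) : ℝ :=
  Real.log (marginalLikelihood π f v n (fun s => X s ω, labels Y n ω)).toReal

namespace IsGaussianRegression

variable {μ : Measure Ω} [IsProbabilityMeasure μ] {γ : Measure 𝒳} [IsProbabilityMeasure γ]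
  {f : Θ × 𝒳 → ℝ} {v : ℝ≥0} {θ : Ω → Θ} {X : ℕ → Ω → 𝒳} {W Y : ℕ → Ω → ℝ}

theorem measurable_label (h : IsGaussianRegression μ π γ f v θ X W Y) (t : ℕ) :
    Measurable (Y t) := by
  have : Y t = fun ω => f (θ ω, X t ω) + W t ω := funext (h.label_eq t)
  rw [this]
  exact (h.measurable_fun.comp (h.measurable_latent.prodMk (h.measurable_input t))).add
    (h.measurable_noise t)

theorem measurable_labels (h : IsGaussianRegression μ π γ f v θ X W Y) (n : ℕ) :
    Measurable (labels Y n) :=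
  measurable_pi_lambda _ fun s => h.measurable_label s

theorem measurable_inputs (h : IsGaussianRegression μ π γ f v θ X W Y) (n : ℕ) :
    Measurable fun ω => fun s : Fin n => X s ω :=
  measurable_pi_lambda _ fun s => h.measurable_input s

/-- The numbers of inputs and labels are decoupled because the history at time t contains t + 1
inputs but only t labels. -/
theorem map_latent_inputs_labels (h : IsGaussianRegression μ π γ f v θ X W Y) (hv : v ≠ 0)
    {m n : ℕ} (hmn : m ≤ n) :
    μ.map (fun ω => ((θ ω, fun s : Fin n => X s ω), labels Y m ω)) =
      ((π.prod (Measure.pi fun _ => γ)).prod volume).withDensity fun p =>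
        likelihood f v m p.1.1 (fun s => p.1.2 (Fin.castLE hmn s), p.2) := by
  have hF : Measurable fun (e : Θ × (Fin n → 𝒳)) (s : Fin m) => f (e.1, e.2 (Fin.castLE hmn s)) :=
    measurable_pi_lambda _ fun s =>
      h.measurable_fun.comp (f := fun e : Θ × (Fin n → 𝒳) => (e.1, e.2 (Fin.castLE hmn s)))
        (by fun_prop)
  have hm : Measurable fun ω => ((θ ω, fun s : Fin n => X s ω), fun s : Fin m => W s ω) :=
    (h.measurable_latent.prodMk (h.measurable_inputs n)).prodMk
      (measurable_pi_lambda _ fun s => h.measurable_noise s)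
  have key := map_add_gaussian_noise (π.prod (Measure.pi fun _ : Fin n => γ)) hv hF
  have hadd : Measurable fun p : (Θ × (Fin n → 𝒳)) × (Fin m → ℝ) =>
      (p.1, (fun s => f (p.1.1, p.1.2 (Fin.castLE hmn s))) + p.2) :=
    measurable_fst.prodMk ((hF.comp measurable_fst).add measurable_snd)
  rw [← h.law_joint n m, Measure.map_map hadd hm] at key
  refine Eq.trans ?_ key
  congr 1
  ext1 ω
  simp only [Function.comp]
  congr 1
  ext s
  simp [labels, h.label_eq]

theorem map_inputs_labels (h : IsGaussianRegression μ π γ f v θ X W Y) (hv : v ≠ 0)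
    {m n : ℕ} (hmn : m ≤ n) :
    μ.map (fun ω => ((fun s : Fin n => X s ω), labels Y m ω)) =
      ((Measure.pi fun _ => γ).prod volume).withDensity fun p =>
        marginalLikelihood π f v m (fun s => p.1 (Fin.castLE hmn s), p.2) := by
  have hg : Measurable fun p : Θ × ((Fin n → 𝒳) × (Fin m → ℝ)) =>
      likelihood f v m p.1 (fun s => p.2.1 (Fin.castLE hmn s), p.2.2) :=
    (measurable_likelihood h.measurable_fun v m).comp
      (f := fun p : Θ × ((Fin n → 𝒳) × (Fin m → ℝ)) =>
        (p.1, ((fun s => p.2.1 (Fin.castLE hmn s)), p.2.2))) (by fun_prop)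
  have hm : Measurable fun ω => ((θ ω, fun s : Fin n => X s ω), labels Y m ω) :=
    (h.measurable_latent.prodMk (h.measurable_inputs n)).prodMk (h.measurable_labels m)
  have hassoc := (measurePreserving_prodAssoc π (Measure.pi fun _ : Fin n => γ)
    (volume : Measure (Fin m → ℝ)))
  have key := map_snd_withDensity (μ := π)
    (ν := (Measure.pi fun _ : Fin n => γ).prod (volume : Measure (Fin m → ℝ))) hg
  rw [← hassoc.map_eq, ← map_withDensity_comp hassoc.measurable hg] at key
  have e := h.map_latent_inputs_labels hv hmn
  rw [Measure.map_map measurable_snd hassoc.measurable] at key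
  have key' := (congrArg (Measure.map (Prod.snd ∘ MeasurableEquiv.prodAssoc)) e).trans key
  rw [Measure.map_map (measurable_snd.comp hassoc.measurable) hm] at key'
  exact key'

theorem map_history (h : IsGaussianRegression μ π γ f v θ X W Y) (hv : v ≠ 0) (t : ℕ) :
    μ.map (history X Y t) =
      ((Measure.pi fun _ => γ).prod volume).withDensity fun p =>
        marginalLikelihood π f v t (fun s => p.1 s.castSucc, p.2) :=
  h.map_inputs_labels hv t.le_succ

theorem map_history_label (h : IsGaussianRegression μ π γ f v θ X W Y) (hv : v ≠ 0) (t : ℕ) :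
    μ.map (fun ω => (history X Y t ω, Y t ω)) =
      (((Measure.pi fun _ => γ).prod volume).prod volume).withDensity fun p =>
        marginalLikelihood π f v (t + 1) (p.1.1, (splitLast t).symm (p.1.2, p.2)) := by
  have hg : Measurable fun p : ((Fin (t + 1) → 𝒳) × (Fin t → ℝ)) × ℝ =>
      marginalLikelihood π f v (t + 1) (p.1.1, (splitLast t).symm (p.1.2, p.2)) :=
    (measurable_marginalLikelihood π h.measurable_fun v (t + 1)).comp (by fun_prop)
  -- Regrouping (inputs, all labels) as ((inputs, past labels), last label) preserves the reference
  -- measure, so the density is only re-indexed.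
  have hmp := ((measurePreserving_prodAssoc (Measure.pi fun _ : Fin (t + 1) => γ)
    (volume : Measure (Fin t → ℝ)) (volume : Measure ℝ)).symm).comp
    ((MeasurePreserving.id (Measure.pi fun _ : Fin (t + 1) => γ)).prod
      (measurePreserving_splitLast t))
  rw [← hmp.map_eq, ← map_withDensity_comp hmp.measurable hg]
  have e := h.map_inputs_labels hv (le_refl (t + 1))
  have e2 : (fun p : (Fin (t + 1) → 𝒳) × (Fin (t + 1) → ℝ) =>
      marginalLikelihood π f v (t + 1) (fun s => p.1 (Fin.castLE le_rfl s), p.2)) =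
      fun p => marginalLikelihood π f v (t + 1)
        (((MeasurableEquiv.prodAssoc.symm ∘ Prod.map id (splitLast t)) p).1.1, (splitLast t).symm
          (((MeasurableEquiv.prodAssoc.symm ∘ Prod.map id (splitLast t)) p).1.2,
            ((MeasurableEquiv.prodAssoc.symm ∘ Prod.map id (splitLast t)) p).2)) := by
    ext p
    have : (splitLast t).symm (splitLast t p.2) = p.2 := (splitLast t).symm_apply_apply _
    simp [MeasurableEquiv.prodAssoc, this]
  rw [e2] at e
  rw [← show _ = _ from e, Measure.map_map hmp.measurable
    ((h.measurable_inputs _).prodMk (h.measurable_labels _))]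
  congr 1
  ext1 ω
  simp [MeasurableEquiv.prodAssoc, splitLast_apply, history, labels]

theorem measurable_history (h : IsGaussianRegression μ π γ f v θ X W Y) (t : ℕ) :
    Measurable (history X Y t) :=
  (h.measurable_inputs (t + 1)).prodMk (h.measurable_labels t)

theorem posterior_absolutelyContinuous (h : IsGaussianRegression μ π γ f v θ X W Y)
    (hv : v ≠ 0) (t : ℕ) :
    ∀ᵐ z ∂(μ.map (history X Y t)), posteriorPredictive μ X Y t z ≪ volume := by
  have hM := measurable_marginalLikelihood π h.measurable_fun v
  exact (kernelDensity_condDistrib (h.measurable_history t) (h.measurable_label t)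
    ((hM t).comp (by fun_prop)) ((hM (t + 1)).comp (by fun_prop))
    (fun _ => marginalLikelihood_ne_zero h.measurable_fun hv _)
    (fun _ => marginalLikelihood_ne_top f hv _)
    (h.map_history hv t) (h.map_history_label hv t)).1

/-- The log-loss of the posterior predictive distribution is an increment of the log-evidence. -/
theorem logLoss_posterior (h : IsGaussianRegression μ π γ f v θ X W Y) (hv : v ≠ 0) (t : ℕ) :
    logLoss μ (history X Y t) (Y t) (posteriorPredictive μ X Y t) =ᵐ[μ] fun ω =>
      logEvidence π f v X Y t ω - logEvidence π f v X Y (t + 1) ω := by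
  have hM := measurable_marginalLikelihood π h.measurable_fun v
  have key := logLoss_condDistrib (h.measurable_history t) (h.measurable_label t)
    ((hM t).comp (by fun_prop)) ((hM (t + 1)).comp (by fun_prop))
    (fun _ => marginalLikelihood_ne_zero h.measurable_fun hv _)
    (fun _ => marginalLikelihood_ne_top f hv _)
    (fun _ => marginalLikelihood_ne_zero h.measurable_fun hv _)
    (fun _ => marginalLikelihood_ne_top f hv _)
    (h.map_history hv t) (h.map_history_label hv t)
  filter_upwards [key] with ω hω
  refine hω.trans ?_
  have : (splitLast t).symm (labels Y t ω, Y t ω) = labels Y (t + 1) ω := by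
    rw [MeasurableEquiv.symm_apply_eq, splitLast_apply]
    rfl
  simp only [logEvidence, history, Function.comp, Fin.val_castSucc]
  rw [← this]
  rfl

theorem map_latentInputs (h : IsGaussianRegression μ π γ f v θ X W Y) (n : ℕ) :
    μ.map (latentInputs θ X n) = π.prod (Measure.pi fun _ => γ) := by
  have hm : Measurable fun ω => ((θ ω, fun s : Fin n => X s ω), fun s : Fin 0 => W s ω) :=
    (h.measurable_latent.prodMk (h.measurable_inputs n)).prodMk
      (measurable_pi_lambda _ fun s => h.measurable_noise s)
  have := congrArg (Measure.map Prod.fst) (h.law_joint n 0)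
  rwa [Measure.map_map measurable_fst hm, ← Measure.fst, Measure.fst_prod] at this

theorem latent_absolutelyContinuous (h : IsGaussianRegression μ π γ f v θ X W Y)
    (hv : v ≠ 0) (n : ℕ) :
    ∀ᵐ z ∂(μ.map (latentInputs θ X n)),
      condDistrib (labels Y n) (latentInputs θ X n) μ z ≪ volume :=
  (kernelDensity_condDistrib (g := 1) (h.measurable_latent.prodMk (h.measurable_inputs n))
    (h.measurable_labels n) measurable_one
    ((measurable_likelihood h.measurable_fun v n).comp
      (f := fun p : (Θ × (Fin n → 𝒳)) × (Fin n → ℝ) =>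
        (p.1.1, ((fun s => p.1.2 (Fin.castLE le_rfl s)), p.2))) (by fun_prop))
    (by simp) (by simp) (by rw [withDensity_one]; exact h.map_latentInputs n)
    (h.map_latent_inputs_labels hv le_rfl)).1

/-- Once the latent variable and inputs are known, the residual of each label is exactly the noise.
The law of the conditioning variables serves as the reference measure, whence the marginal density
`g := 1`. -/
theorem logLoss_latent (h : IsGaussianRegression μ π γ f v θ X W Y) (hv : v ≠ 0) (n : ℕ) :
    logLoss μ (latentInputs θ X n) (labels Y n)
        (condDistrib (labels Y n) (latentInputs θ X n) μ) =ᵐ[μ] fun ω =>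
      ∑ s : Fin n, (Real.log √(2 * Real.pi * v) + W s ω ^ 2 / (2 * v)) := by
  have key := logLoss_condDistrib (g := 1) (h.measurable_latent.prodMk (h.measurable_inputs n))
    (h.measurable_labels n) measurable_one
    ((measurable_likelihood h.measurable_fun v n).comp
      (f := fun p : (Θ × (Fin n → 𝒳)) × (Fin n → ℝ) =>
        (p.1.1, ((fun s => p.1.2 (Fin.castLE le_rfl s)), p.2))) (by fun_prop))
    (by simp) (by simp) (fun _ => likelihood_ne_zero f hv _ _) (fun _ => likelihood_ne_top f v _ _)
    (by rw [withDensity_one]; exact h.map_latentInputs n)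
    (h.map_latent_inputs_labels hv le_rfl)
  filter_upwards [key] with ω hω
  refine hω.trans ?_
  simp only [Pi.one_apply, ENNReal.toReal_one, Real.log_one, zero_sub, Function.comp]
  rw [likelihood_eq_exp f hv, ENNReal.toReal_ofReal (Real.exp_pos _).le, Real.log_exp, neg_neg]
  refine Finset.sum_congr rfl fun s _ => ?_
  simp [labels, h.label_eq]

end IsGaussianRegression

end Regression

/-! ### Variational bound on the log-evidence -/

section Regression

variable {Ω Θ 𝒳 : Type*} [MeasurableSpace Ω] [MeasurableSpace Θ] [MeasurableSpace 𝒳]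

/-- Jensen's inequality for the logarithm of an exponential moment. -/
theorem neg_log_lintegral_exp_le {E : Type*} [MeasurableSpace E] {κ : Measure E}
    [IsProbabilityMeasure κ] {g : E → ℝ} (hg : Integrable g κ)
    (hfin : ∫⁻ e, ENNReal.ofReal (Real.exp (-g e)) ∂κ ≠ ∞) :
    -Real.log (∫⁻ e, ENNReal.ofReal (Real.exp (-g e)) ∂κ).toReal ≤ ∫ e, g e ∂κ := by
  have hm : AEStronglyMeasurable (fun e => Real.exp (-g e)) κ :=
    Real.continuous_exp.comp_aestronglyMeasurable hg.neg.aestronglyMeasurable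
  have hexp : Integrable (fun e => Real.exp (-g e)) κ :=
    (lintegral_ofReal_ne_top_iff_integrable hm
      (Filter.Eventually.of_forall fun _ => (Real.exp_pos _).le)).1 hfin
  rw [← integral_eq_lintegral_of_nonneg_ae
    (Filter.Eventually.of_forall fun _ => (Real.exp_pos _).le) hm]
  have hj : Real.exp (∫ e, -g e ∂κ) ≤ ∫ e, Real.exp (-g e) ∂κ :=
    convexOn_exp.map_integral_le Real.continuous_exp.continuousOn isClosed_univ
      (Filter.Eventually.of_forall fun _ => trivial) hg.neg hexp
  have hlog := Real.log_le_log (Real.exp_pos _) hj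
  rw [Real.log_exp, integral_neg] at hlog
  linarith

namespace IsGaussianRegression

variable {π : Measure Θ} [IsProbabilityMeasure π]
  {μ : Measure Ω} [IsProbabilityMeasure μ] {γ : Measure 𝒳} [IsProbabilityMeasure γ]
  {f : Θ × 𝒳 → ℝ} {v : ℝ≥0} {θ : Ω → Θ} {X : ℕ → Ω → 𝒳} {W Y : ℕ → Ω → ℝ}

theorem memLp_noise (h : IsGaussianRegression μ π γ f v θ X W Y) (t : ℕ) : MemLp (W t) 2 μ := by
  have := memLp_id_gaussianReal' (μ := 0) (v := v) 2 (by simp)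
  rw [← h.law_noise t] at this
  exact (memLp_map_measure_iff aestronglyMeasurable_id (h.measurable_noise t).aemeasurable).1 this

theorem integral_noise (h : IsGaussianRegression μ π γ f v θ X W Y) (t : ℕ) :
    ∫ ω, W t ω ∂μ = 0 := by
  have := integral_id_gaussianReal (μ := 0) (v := v)
  rwa [← h.law_noise t, integral_map (h.measurable_noise t).aemeasurable (by fun_prop)] at this

theorem integral_noise_sq (h : IsGaussianRegression μ π γ f v θ X W Y) (t : ℕ) :
    ∫ ω, W t ω ^ 2 ∂μ = v := by
  have h1 := variance_fun_id_gaussianReal (μ := 0) (v := v)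
  rw [variance_of_integral_eq_zero (by fun_prop) (by simp),
    ← h.law_noise t, integral_map (h.measurable_noise t).aemeasurable
      (by fun_prop)] at h1
  exact h1

theorem measurable_logEvidence (h : IsGaussianRegression μ π γ f v θ X W Y) (n : ℕ) :
    Measurable (logEvidence π f v X Y n) :=
  (((measurable_marginalLikelihood π h.measurable_fun v n).comp
    ((h.measurable_inputs n).prodMk (h.measurable_labels n))).ennreal_toReal).log

theorem logEvidence_zero (ω : Ω) : logEvidence π f v X Y 0 ω = 0 := by
  simp [logEvidence, marginalLikelihood, likelihood]

theorem logEvidence_le (h : IsGaussianRegression μ π γ f v θ X W Y) (hv : v ≠ 0) (n : ℕ)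
    (ω : Ω) : logEvidence π f v X Y n ω ≤ -(n * Real.log √(2 * Real.pi * v)) := by
  rw [logEvidence, Real.log_le_iff_le_exp (ENNReal.toReal_pos
    (marginalLikelihood_ne_zero h.measurable_fun hv _) (marginalLikelihood_ne_top f hv _))]
  exact ENNReal.toReal_le_of_le_ofReal (Real.exp_pos _).le (marginalLikelihood_le f hv _)

/-- If the log-evidence is integrable, then the log-losses are integrable and the estimation
error telescopes. -/
theorem estimationError_eq (h : IsGaussianRegression μ π γ f v θ X W Y) (hv : v ≠ 0)
    (hint : ∀ n, Integrable (logEvidence π f v X Y n) μ) (T : ℕ) (hT : 1 ≤ T) :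
    (∀ t, HasFiniteLogLoss μ (history X Y t) (Y t) (posteriorPredictive μ X Y t)) ∧
    HasFiniteLogLoss μ (latentInputs θ X T) (labels Y T)
      (condDistrib (labels Y T) (latentInputs θ X T) μ) ∧
    estimationError μ θ X Y T = (1 / (T : ℝ)) * ∫ ω, -logEvidence π f v X Y T ω ∂μ
      - (Real.log √(2 * Real.pi * v) + 1 / 2) := by
  have hW : ∀ s : ℕ, Integrable (fun ω => Real.log √(2 * Real.pi * v) + W s ω ^ 2 / (2 * v)) μ :=
    fun s => (integrable_const _).add ((h.memLp_noise s).integrable_sq.div_const _)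
  have hsum : Integrable (fun ω => ∑ s : Fin T,
      (Real.log √(2 * Real.pi * v) + W s ω ^ 2 / (2 * v))) μ :=
    integrable_finsetSum _ fun s _ => hW s
  refine ⟨fun t => ⟨h.posterior_absolutelyContinuous hv t, ?_⟩,
    ⟨h.latent_absolutelyContinuous hv T, ?_⟩, ?_⟩
  · exact ((hint t).sub (hint (t + 1))).congr (h.logLoss_posterior hv t).symm
  · exact hsum.congr (h.logLoss_latent hv T).symm
  · have h1 : ∀ t, ∫ ω, logLoss μ (history X Y t) (Y t) (posteriorPredictive μ X Y t) ω ∂μ =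
        ∫ ω, logEvidence π f v X Y t ω ∂μ - ∫ ω, logEvidence π f v X Y (t + 1) ω ∂μ := fun t => by
      rw [integral_congr_ae (h.logLoss_posterior hv t), integral_sub (hint t) (hint (t + 1))]
    have hv' : (v : ℝ) ≠ 0 := by exact_mod_cast hv
    have h2 : condDiffEntropy μ (labels Y T) (latentInputs θ X T) =
        T * (Real.log √(2 * Real.pi * v) + 1 / 2) := by
      rw [condDiffEntropy, integral_congr_ae (h.logLoss_latent hv T),
        integral_finsetSum _ fun (s : Fin T) _ => hW s]
      have : ∀ s : Fin T, ∫ ω, (Real.log √(2 * Real.pi * v) + W s ω ^ 2 / (2 * v)) ∂μ =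
          Real.log √(2 * Real.pi * v) + 1 / 2 := fun s => by
        rw [integral_add (integrable_const _) ((h.memLp_noise s).integrable_sq.div_const _),
          integral_div, h.integral_noise_sq]
        simp only [integral_const, probReal_univ, one_smul]
        field_simp
      rw [Finset.sum_congr rfl fun s _ => this s, Finset.sum_const, Finset.card_univ,
        Fintype.card_fin, nsmul_eq_mul]
    have hT' : (T : ℝ) ≠ 0 := by positivity
    rw [estimationError, h2, Finset.sum_congr rfl fun t _ => h1 t, Finset.sum_range_sub',
      integral_neg]
    -- The likelihood of no labels is the empty product 1, so only the final log-evidence survives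
    -- the telescoping.
    have h0 : ∫ ω, logEvidence π f v X Y 0 ω ∂μ = 0 := by simp [logEvidence_zero]
    rw [h0]
    field_simp
    ring

variable {E : Type*} [MeasurableSpace E] {κ : Measure E} [IsProbabilityMeasure κ]
  {sh : Θ × E → Θ} {q : Θ × E → ℝ}

/-- The exponent in the change of measure from the prior to the law of a perturbed latent
variable. -/
def perturbedLoss (f : Θ × 𝒳 → ℝ) (v : ℝ≥0) (θ : Ω → Θ) (X : ℕ → Ω → 𝒳) (W : ℕ → Ω → ℝ)
    (sh : Θ × E → Θ) (q : Θ × E → ℝ) (n : ℕ) (p : Ω × E) : ℝ :=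
  ∑ s : Fin n, (Real.log √(2 * Real.pi * v) +
    (W s p.1 + (f (θ p.1, X s p.1) - f (sh (θ p.1, p.2), X s p.1))) ^ 2 / (2 * v)) +
    q (θ p.1, p.2)

/-- The prior is rewritten through `hshift` around the true latent value `θ ω`. The candidate latent
variable becomes a perturbation of the truth, and the change-of-measure density joins the likelihood
in one exponent. -/
theorem marginalLikelihood_eq_perturbed (h : IsGaussianRegression μ π γ f v θ X W Y)
    (hv : v ≠ 0) (hsh : Measurable sh) (hq : Measurable q)
    (hshift : ∀ a, π = (κ.withDensity fun e => ENNReal.ofReal (Real.exp (-q (a, e)))).map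
      fun e => sh (a, e)) (n : ℕ) (ω : Ω) :
    marginalLikelihood π f v n (fun s => X s ω, labels Y n ω) =
      ∫⁻ e, ENNReal.ofReal (Real.exp (-perturbedLoss f v θ X W sh q n (ω, e))) ∂κ := by
  have hm : Measurable fun a => likelihood f v n a (fun s => X s ω, labels Y n ω) :=
    (measurable_likelihood h.measurable_fun v n).comp
      (f := fun a => (a, ((fun s : Fin n => X s ω), labels Y n ω))) (by fun_prop)
  have hsh' : Measurable fun e => sh (θ ω, e) := hsh.comp (by fun_prop)
  have hq' : Measurable fun e => ENNReal.ofReal (Real.exp (-q (θ ω, e))) := by fun_prop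
  rw [marginalLikelihood]
  conv_lhs => rw [hshift (θ ω)]
  rw [lintegral_map hm hsh', 
    lintegral_withDensity_eq_lintegral_mul _ hq' (show Measurable fun e =>
      likelihood f v n (sh (θ ω, e)) (fun s => X s ω, labels Y n ω) from hm.comp hsh')]
  refine lintegral_congr fun e => ?_
  simp only [Pi.mul_apply]
  rw [likelihood_eq_exp f hv, ← ENNReal.ofReal_mul (Real.exp_pos _).le, ← Real.exp_add,
    perturbedLoss, neg_add, add_comm]
  congr 4
  refine Finset.sum_congr rfl fun s _ => ?_
  simp only [labels, h.label_eq]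
  ring_nf

/-- The residual of the perturbed model is noise plus output mismatch. Its mean square splits into
the noise variance and the distortion, because the noise is centred and independent of everything
that enters the mismatch. -/
theorem integrable_perturbedLoss (h : IsGaussianRegression μ π γ f v θ X W Y)
    (hv : v ≠ 0) (hsh : Measurable sh)
    (hqi : Integrable q (π.prod κ))
    (hdi : Integrable (fun p : (Θ × 𝒳) × E => (f (p.1.1, p.1.2) - f (sh (p.1.1, p.2), p.1.2)) ^ 2)
      ((π.prod γ).prod κ)) (n : ℕ) :
    Integrable (perturbedLoss f v θ X W sh q n) (μ.prod κ) ∧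
    ∫ p, perturbedLoss f v θ X W sh q n p ∂(μ.prod κ) =
      n * (Real.log √(2 * Real.pi * v) + 1 / 2) +
      n * ((∫ p, (f (p.1.1, p.1.2) - f (sh (p.1.1, p.2), p.1.2)) ^ 2 ∂((π.prod γ).prod κ)) /
        (2 * v)) + ∫ p, q p ∂(π.prod κ) := by
  have hf := h.measurable_fun
  have hv' : (v : ℝ) ≠ 0 := by exact_mod_cast hv
  have hθ := h.measurable_latent
  have hX := h.measurable_input
  have hW := h.measurable_noise
  have hlawθ : μ.map θ = π := by
    have := congrArg (Measure.map Prod.fst) (h.law_latent_input 0)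
    rwa [Measure.map_map measurable_fst (hθ.prodMk (hX 0)), ← Measure.fst,
      Measure.fst_prod] at this
  have hmpq : MeasurePreserving (fun p : Ω × E => (θ p.1, p.2)) (μ.prod κ) (π.prod κ) :=
    (MeasurePreserving.mk hθ hlawθ).prod (MeasurePreserving.id κ)
  have hmpd : ∀ s, MeasurePreserving (fun p : Ω × E => ((θ p.1, X s p.1), p.2)) (μ.prod κ)
      ((π.prod γ).prod κ) := fun s =>
    (MeasurePreserving.mk (hθ.prodMk (hX s)) (h.law_latent_input s)).prod (MeasurePreserving.id κ)
  set D : (Θ × 𝒳) × E → ℝ := fun p => f (p.1.1, p.1.2) - f (sh (p.1.1, p.2), p.1.2) with hD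
  have hDm : Measurable D := by
    refine (hf.comp (by fun_prop)).sub (hf.comp (Measurable.prodMk ?_ (by fun_prop)))
    exact hsh.comp (by fun_prop)
  have hDL : ∀ s, MemLp (fun p : Ω × E => D ((θ p.1, X s p.1), p.2)) 2 (μ.prod κ) := fun s =>
    ((memLp_two_iff_integrable_sq hDm.aestronglyMeasurable).2 hdi).comp_measurePreserving (hmpd s)
  have hWL : ∀ s, MemLp (fun p : Ω × E => W s p.1) 2 (μ.prod κ) := fun s =>
    (h.memLp_noise s).comp_measurePreserving measurePreserving_fst
  have hqi' : Integrable (fun p : Ω × E => q (θ p.1, p.2)) (μ.prod κ) :=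
    hmpq.integrable_comp_of_integrable hqi
  have hsq : ∀ s, Integrable (fun p : Ω × E => (W s p.1 + D ((θ p.1, X s p.1), p.2)) ^ 2)
      (μ.prod κ) := fun s => ((hWL s).add (hDL s)).integrable_sq
  have hterm : ∀ s, Integrable (fun p : Ω × E => Real.log √(2 * Real.pi * v) +
      (W s p.1 + D ((θ p.1, X s p.1), p.2)) ^ 2 / (2 * v)) (μ.prod κ) := fun s =>
    (integrable_const _).add ((hsq s).div_const _)
  -- With the perturbation `e` frozen, the mismatch is a function of the latent variable and the
  -- input only, so it is independent of the noise.
  have hcross : ∀ s, ∫ p : Ω × E, W s p.1 * D ((θ p.1, X s p.1), p.2) ∂(μ.prod κ) = 0 := by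
    intro s
    rw [integral_prod_symm (fun p : Ω × E => W s p.1 * D ((θ p.1, X s p.1), p.2))
      ((hWL s).integrable_mul (hDL s))]
    refine integral_eq_zero_of_ae (Filter.Eventually.of_forall fun e => ?_)
    have hDe : Measurable fun z : Θ × 𝒳 => D (z, e) := hDm.comp (by fun_prop)
    have hi : IndepFun (W s) (fun ω => D ((θ ω, X s ω), e)) μ :=
      ((h.indep_noise s).comp hDe measurable_id).symm
    simp only [Pi.zero_apply]
    rw [hi.integral_fun_mul_eq_mul_integral (hW s).aestronglyMeasurable
      (hDe.comp (hθ.prodMk (hX s))).aestronglyMeasurable, h.integral_noise, zero_mul]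
  have hWsq : ∀ s, ∫ p : Ω × E, W s p.1 ^ 2 ∂(μ.prod κ) = v := fun s => by
    rw [integral_fun_fst (fun ω => W s ω ^ 2), h.integral_noise_sq]; simp
  have hDsq : ∀ s, ∫ p : Ω × E, D ((θ p.1, X s p.1), p.2) ^ 2 ∂(μ.prod κ) =
      ∫ p, D p ^ 2 ∂((π.prod γ).prod κ) := fun s => by
    rw [← (hmpd s).map_eq, integral_map (hmpd s).measurable.aemeasurable
      (hDm.pow_const 2).aestronglyMeasurable]
  have hint : ∀ s, ∫ p : Ω × E, (Real.log √(2 * Real.pi * v) +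
      (W s p.1 + D ((θ p.1, X s p.1), p.2)) ^ 2 / (2 * v)) ∂(μ.prod κ) =
      (Real.log √(2 * Real.pi * v) + 1 / 2) +
        (∫ p, D p ^ 2 ∂((π.prod γ).prod κ)) / (2 * v) := by
    intro s
    rw [integral_add (integrable_const _) ((hsq s).div_const _), integral_div]
    have : ∫ p : Ω × E, (W s p.1 + D ((θ p.1, X s p.1), p.2)) ^ 2 ∂(μ.prod κ) =
        v + ∫ p, D p ^ 2 ∂((π.prod γ).prod κ) := by
      have e : ∀ p : Ω × E, (W s p.1 + D ((θ p.1, X s p.1), p.2)) ^ 2 =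
          W s p.1 ^ 2 + 2 * (W s p.1 * D ((θ p.1, X s p.1), p.2)) +
            D ((θ p.1, X s p.1), p.2) ^ 2 := fun p => by ring
      simp_rw [e]
      have hi1 := (hWL s).integrable_sq
      have hi2 : Integrable (fun p : Ω × E => 2 * (W s p.1 * D ((θ p.1, X s p.1), p.2)))
          (μ.prod κ) := ((hWL s).integrable_mul (hDL s)).const_mul 2
      have hi3 := (hDL s).integrable_sq
      rw [integral_add (show Integrable (fun p : Ω × E => W s p.1 ^ 2 + _) _ from hi1.add hi2) hi3,
        integral_add hi1 hi2, integral_const_mul,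
        hcross s, hWsq s, hDsq s]
      ring
    rw [this]
    simp only [integral_const, probReal_univ, one_smul]
    field_simp
    ring
  have hsum : Integrable (fun p : Ω × E => ∑ s : Fin n, (Real.log √(2 * Real.pi * v) +
      (W s p.1 + D ((θ p.1, X s p.1), p.2)) ^ 2 / (2 * v))) (μ.prod κ) :=
    integrable_finsetSum _ fun s _ => hterm s
  refine ⟨hsum.add hqi', ?_⟩
  have e1 : ∫ p, perturbedLoss f v θ X W sh q n p ∂(μ.prod κ) =
      ∑ s : Fin n, ∫ p : Ω × E, (Real.log √(2 * Real.pi * v) +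
        (W s p.1 + D ((θ p.1, X s p.1), p.2)) ^ 2 / (2 * v)) ∂(μ.prod κ) +
      ∫ p : Ω × E, q (θ p.1, p.2) ∂(μ.prod κ) := by
    rw [← integral_finsetSum _ fun (s : Fin n) _ => hterm s, ← integral_add hsum hqi']
    rfl
  have e2 : ∫ p : Ω × E, q (θ p.1, p.2) ∂(μ.prod κ) = ∫ p, q p ∂(π.prod κ) := by
    rw [← hmpq.map_eq, integral_map hmpq.measurable.aemeasurable]
    rw [hmpq.map_eq]; exact hqi.aestronglyMeasurable
  rw [e1, e2, Finset.sum_congr rfl fun (s : Fin n) _ => hint s]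
  simp only [Finset.sum_const, Finset.card_univ, Fintype.card_fin, nsmul_eq_mul]
  ring

theorem logEvidence_bound (h : IsGaussianRegression μ π γ f v θ X W Y)
    (hv : v ≠ 0) (hsh : Measurable sh) (hq : Measurable q)
    (hshift : ∀ a, π = (κ.withDensity fun e => ENNReal.ofReal (Real.exp (-q (a, e)))).map
      fun e => sh (a, e))
    (hqi : Integrable q (π.prod κ))
    (hdi : Integrable (fun p : (Θ × 𝒳) × E => (f (p.1.1, p.1.2) - f (sh (p.1.1, p.2), p.1.2)) ^ 2)
      ((π.prod γ).prod κ)) (n : ℕ) :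
    Integrable (logEvidence π f v X Y n) μ ∧
    ∫ ω, -logEvidence π f v X Y n ω ∂μ ≤
      n * (Real.log √(2 * Real.pi * v) + 1 / 2) +
      n * ((∫ p, (f (p.1.1, p.1.2) - f (sh (p.1.1, p.2), p.1.2)) ^ 2 ∂((π.prod γ).prod κ)) /
        (2 * v)) + ∫ p, q p ∂(π.prod κ) := by
  obtain ⟨hi, hI⟩ := h.integrable_perturbedLoss hv hsh hqi hdi n
  have hle : ∀ᵐ ω ∂μ, -logEvidence π f v X Y n ω ≤
      ∫ e, perturbedLoss f v θ X W sh q n (ω, e) ∂κ := by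
    filter_upwards [hi.prod_right_ae] with ω hω
    have e := h.marginalLikelihood_eq_perturbed hv hsh hq hshift n ω
    rw [logEvidence, e]
    refine neg_log_lintegral_exp_le hω ?_
    rw [← e]
    exact marginalLikelihood_ne_top f hv _
  -- The negative log-evidence lies between a constant, from the peak of the Gaussian density, and
  -- the integrable upper bound from Jensen.
  have hint : Integrable (logEvidence π f v X Y n) μ := by
    refine integrable_neg_iff.1 (integrable_of_le_of_le (h.measurable_logEvidence n).neg.aestronglyMeasurable
      (Filter.Eventually.of_forall fun ω => ?_) hle
      (integrable_const (n * Real.log √(2 * Real.pi * v))) hi.integral_prod_left)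
    have := h.logEvidence_le hv n ω
    simp only [Pi.neg_apply]
    linarith
  refine ⟨hint, ?_⟩
  rw [← hI, integral_prod _ hi]
  exact integral_mono_ae hint.neg hi.integral_prod_left hle

/-- The estimation error is at most the distortion plus the information needed to describe a
perturbed latent variable. -/
theorem estimationError_le (h : IsGaussianRegression μ π γ f v θ X W Y)
    (hv : v ≠ 0) (hsh : Measurable sh) (hq : Measurable q)
    (hshift : ∀ a, π = (κ.withDensity fun e => ENNReal.ofReal (Real.exp (-q (a, e)))).map
      fun e => sh (a, e))
    (hqi : Integrable q (π.prod κ))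
    (hdi : Integrable (fun p : (Θ × 𝒳) × E => (f (p.1.1, p.1.2) - f (sh (p.1.1, p.2), p.1.2)) ^ 2)
      ((π.prod γ).prod κ)) (T : ℕ) (hT : 1 ≤ T) :
    (∀ t, HasFiniteLogLoss μ (history X Y t) (Y t) (posteriorPredictive μ X Y t)) ∧
    HasFiniteLogLoss μ (latentInputs θ X T) (labels Y T)
      (condDistrib (labels Y T) (latentInputs θ X T) μ) ∧
    estimationError μ θ X Y T ≤
      (∫ p, (f (p.1.1, p.1.2) - f (sh (p.1.1, p.2), p.1.2)) ^ 2 ∂((π.prod γ).prod κ)) / (2 * v) +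
        (∫ p, q p ∂(π.prod κ)) / T := by
  have hb := h.logEvidence_bound hv hsh hq hshift hqi hdi
  obtain ⟨h1, h2, h3⟩ := h.estimationError_eq hv (fun n => (hb n).1) T hT
  refine ⟨h1, h2, ?_⟩
  have hT' : (0 : ℝ) < T := by positivity
  have hbT := mul_le_mul_of_nonneg_left (hb T).2 (one_div_pos.2 hT').le
  rw [h3]
  -- The term ln √(2πv) + 1/2 cancels the conditional entropy per label exactly.
  refine (sub_le_sub_right hbT _).trans (le_of_eq ?_)
  field_simp
  ring

end IsGaussianRegression

end Regression

/-! ### Propagation of weight perturbations through the network -/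

section Network

theorem integral_gaussian_sq (c : ℝ≥0) : ∫ x, x ^ 2 ∂(gaussianReal 0 c) = c := by
  have h1 := variance_fun_id_gaussianReal (μ := 0) (v := c)
  rwa [variance_of_integral_eq_zero (by fun_prop) (by simp)] at h1

theorem lintegral_pi_gaussian_sq {n : ℕ} (c : ℝ≥0) (a : ℝ) (u : Fin n → ℝ) :
    ∫⁻ e, ENNReal.ofReal ((a + ∑ j, e j * u j) ^ 2)
        ∂(Measure.pi fun _ : Fin n => gaussianReal 0 c) =
      ENNReal.ofReal (a ^ 2 + c * ∑ j, u j ^ 2) := by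
  have hL : ∀ j, MemLp (fun x : ℝ => x * u j) 2 (gaussianReal 0 c) := fun j =>
    (memLp_id_gaussianReal' 2 (by simp)).mul_const (u j)
  have hS : ∀ j, MemLp (fun e : Fin n → ℝ => e j * u j) 2
      (Measure.pi fun _ : Fin n => gaussianReal 0 c) := fun j =>
    (hL j).comp_measurePreserving (measurePreserving_eval (fun _ : Fin n => gaussianReal 0 c) j)
  have hV : MemLp (fun e : Fin n → ℝ => ∑ j, e j * u j) 2
      (Measure.pi fun _ : Fin n => gaussianReal 0 c) := memLp_finsetSum _ fun j _ => hS j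
  have hV0 : ∫ e, ∑ j, e j * u j ∂(Measure.pi fun _ : Fin n => gaussianReal 0 c) = 0 := by
    rw [integral_finsetSum _ fun j _ => (hS j).integrable one_le_two]
    refine Finset.sum_eq_zero fun j _ => ?_
    rw [integral_mul_const, integral_comp_eval (μ := fun _ : Fin n => gaussianReal 0 c)
      (f := fun x : ℝ => x) (by fun_prop)]
    simp
  have hV2 : ∫ e, (∑ j, e j * u j) ^ 2 ∂(Measure.pi fun _ : Fin n => gaussianReal 0 c) =
      c * ∑ j, u j ^ 2 := by
    rw [← variance_of_integral_eq_zero hV.aestronglyMeasurable.aemeasurable hV0]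
    have := variance_sum_pi hL
    rw [show (∑ i, fun e : Fin n → ℝ => e i * u i) = fun e => ∑ i, e i * u i by
      ext; simp] at this
    rw [this, Finset.mul_sum]
    refine Finset.sum_congr rfl fun j _ => ?_
    rw [show (fun x : ℝ => x * u j) = fun x => u j * x by ext; ring, variance_const_mul,
      variance_fun_id_gaussianReal]
    ring
  have hI : Integrable (fun e : Fin n → ℝ => (a + ∑ j, e j * u j) ^ 2)
      (Measure.pi fun _ : Fin n => gaussianReal 0 c) := ((memLp_const a).add hV).integrable_sq
  rw [← ofReal_integral_eq_lintegral_ofReal hI (Filter.Eventually.of_forall fun _ => sq_nonneg _)]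
  congr 1
  have e : ∀ e : Fin n → ℝ, (a + ∑ j, e j * u j) ^ 2 =
      (a ^ 2 + 2 * a * ∑ j, e j * u j) + (∑ j, e j * u j) ^ 2 := fun e => by ring
  simp_rw [e]
  have hi1 : Integrable (fun e : Fin n → ℝ => 2 * a * ∑ j, e j * u j)
      (Measure.pi fun _ : Fin n => gaussianReal 0 c) :=
    (hV.integrable one_le_two).const_mul _
  rw [integral_add (show Integrable (fun e : Fin n → ℝ => a ^ 2 + _) _ from
      (integrable_const (a ^ 2)).add hi1) hV.integrable_sq,
    integral_add (integrable_const _) hi1, integral_const_mul, hV0, hV2]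
  simp

/-- The law of an `m × n` matrix with independent centred Gaussian entries of variance `s / n`. -/
def layerLaw (m n : ℕ) (s : ℝ≥0) : Measure (Fin m → Fin n → ℝ) :=
  Measure.pi fun _ => Measure.pi fun _ => gaussianReal 0 (s * (n : ℝ≥0)⁻¹)

instance (m n : ℕ) (s : ℝ≥0) : IsProbabilityMeasure (layerLaw m n s) := by
  unfold layerLaw; infer_instance

/-- For a fixed row the two sums are independent and centred, so their variances add; the m rows
contribute equally. Stating this with `∫⁻` postpones all integrability questions to the final bound.
-/
theorem lintegral_layerLaw_sq (m n : ℕ) (s : ℝ≥0) (w u : Fin n → ℝ) :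
    ∫⁻ b, ∫⁻ c, ENNReal.ofReal (∑ i, (∑ j, b i j * w j + ∑ j, c i j * u j) ^ 2)
        ∂(layerLaw m n s) ∂(layerLaw m n 1) =
      ENNReal.ofReal (m * ((n : ℝ)⁻¹ * (∑ j, w j ^ 2 + s * ∑ j, u j ^ 2))) := by
  have hc : ∀ b : Fin m → Fin n → ℝ,
      ∫⁻ c, ENNReal.ofReal (∑ i, (∑ j, b i j * w j + ∑ j, c i j * u j) ^ 2) ∂(layerLaw m n s) =
      ∑ i, ENNReal.ofReal ((0 + ∑ j, b i j * w j) ^ 2) +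
        ENNReal.ofReal (m * (s * (n : ℝ)⁻¹ * ∑ j, u j ^ 2)) := by
    intro b
    simp_rw [ENNReal.ofReal_sum_of_nonneg fun i _ => sq_nonneg _]
    rw [lintegral_finsetSum _ fun i _ => by fun_prop]
    have : ∀ i, ∫⁻ c, ENNReal.ofReal ((∑ j, b i j * w j + ∑ j, c i j * u j) ^ 2)
        ∂(layerLaw m n s) = ENNReal.ofReal ((0 + ∑ j, b i j * w j) ^ 2) +
          ENNReal.ofReal (s * (n : ℝ)⁻¹ * ∑ j, u j ^ 2) := fun i => by
      rw [layerLaw, (measurePreserving_eval (fun _ : Fin m => Measure.pi fun _ : Fin n =>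
        gaussianReal 0 (s * (n : ℝ≥0)⁻¹)) i).lintegral_comp
          (f := fun r : Fin n → ℝ => ENNReal.ofReal ((∑ j, b i j * w j + ∑ j, r j * u j) ^ 2))
          (by fun_prop), lintegral_pi_gaussian_sq, zero_add,
        ENNReal.ofReal_add (sq_nonneg _) (by positivity)]
      simp
    rw [Finset.sum_congr rfl fun i _ => this i, Finset.sum_add_distrib]
    simp only [Finset.sum_const, Finset.card_univ, Fintype.card_fin, nsmul_eq_mul]
    rw [ENNReal.ofReal_mul (Nat.cast_nonneg m), ENNReal.ofReal_natCast]
  simp_rw [hc]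
  rw [lintegral_add_right _ measurable_const, lintegral_finsetSum _ fun i _ => by fun_prop]
  have : ∀ i, ∫⁻ b, ENNReal.ofReal ((0 + ∑ j, b i j * w j) ^ 2) ∂(layerLaw m n 1) =
      ENNReal.ofReal ((n : ℝ)⁻¹ * ∑ j, w j ^ 2) := fun i => by
    rw [layerLaw, (measurePreserving_eval (fun _ : Fin m => Measure.pi fun _ : Fin n =>
      gaussianReal 0 (1 * (n : ℝ≥0)⁻¹)) i).lintegral_comp
        (f := fun r : Fin n → ℝ => ENNReal.ofReal ((0 + ∑ j, r j * w j) ^ 2))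
        (by fun_prop), lintegral_pi_gaussian_sq]
    simp
  rw [Finset.sum_congr rfl fun i _ => this i]
  simp only [Finset.sum_const, Finset.card_univ, Fintype.card_fin, nsmul_eq_mul, lintegral_const,
    measure_univ, mul_one]
  rw [← ENNReal.ofReal_natCast, ← ENNReal.ofReal_mul (Nat.cast_nonneg m),
    ← ENNReal.ofReal_add (by positivity) (by positivity)]
  congr 1
  ring

variable {d N L : ℕ}

/-- The law of weights whose entries in a layer with input dimension `n` have variance `s / n`. -/
def weightLaw (d N L : ℕ) (s : ℝ≥0) : Measure (Weights d N L) :=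
  Measure.pi fun ℓ : Fin L => layerLaw (layerDim d N L (ℓ + 1)) (layerDim d N L ℓ) s

instance (s : ℝ≥0) : IsProbabilityMeasure (weightLaw d N L s) := by
  unfold weightLaw; infer_instance

theorem prior_eq_weightLaw : prior d N L = weightLaw d N L 1 := by
  simp [prior, weightLaw, layerLaw]

theorem measurable_layerOutput (ℓ : ℕ) (h : ℓ ≤ L) :
    Measurable fun p : Weights d N L × (Fin d → ℝ) => layerOutput p.1 p.2 ℓ h := by
  induction ℓ with
  | zero => exact measurable_snd
  | succ ℓ ih =>
    have ih' := ih (Nat.le_of_succ_le h)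
    refine measurable_pi_lambda _ fun i => ?_
    refine measurable_const.max (Finset.measurable_sum _ fun j _ => ?_)
    refine Measurable.mul ?_ ((measurable_pi_apply j).comp ih')
    fun_prop

/-- The output of a layer depends only on the weights before it, so layer `k` can be integrated out
with its input vector held fixed. -/
theorem layerOutput_update (A : Weights d N L) (x : Fin d → ℝ) (k : Fin L)
    (b : Fin (layerDim d N L (k + 1)) → Fin (layerDim d N L k) → ℝ) (ℓ : ℕ) (h : ℓ ≤ L)
    (hk : ℓ ≤ k) : layerOutput (Function.update A k b) x ℓ h = layerOutput A x ℓ h := by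
  induction ℓ with
  | zero => rfl
  | succ ℓ ih =>
    have hne : (⟨ℓ, h⟩ : Fin L) ≠ k := fun e => by
      have := congrArg Fin.val e
      simp only at this
      omega
    ext i
    simp only [layerOutput]
    rw [ih _ (by omega), Function.update_of_ne hne]

theorem layerOutput_succ_update (A : Weights d N L) (x : Fin d → ℝ) (ℓ : ℕ) (h : ℓ + 1 ≤ L)
    (b : Fin (layerDim d N L (ℓ + 1)) → Fin (layerDim d N L ℓ) → ℝ) (i) :
    layerOutput (Function.update A ⟨ℓ, h⟩ b) x (ℓ + 1) h i =
      max 0 (∑ j, b i j * layerOutput A x ℓ (Nat.le_of_succ_le h) j) := by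
  simp only [layerOutput]
  rw [layerOutput_update A x ⟨ℓ, h⟩ b ℓ _ le_rfl, Function.update_self]

/-- Shrinking the weights by the factor `r` and adding a perturbation. -/
def perturb (r : ℝ) (p : Weights d N L × Weights d N L) : Weights d N L :=
  fun ℓ i j => r * p.1 ℓ i j + p.2 ℓ i j

theorem measurable_perturb (r : ℝ) : Measurable (perturb (d := d) (N := N) (L := L) r) := by
  unfold perturb
  fun_prop

theorem perturb_update (r : ℝ) (A B : Weights d N L) (k : Fin L)
    (b c : Fin (layerDim d N L (k + 1)) → Fin (layerDim d N L k) → ℝ) :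
    perturb r (Function.update A k b, Function.update B k c) =
      Function.update (perturb r (A, B)) k fun i j => r * b i j + c i j := by
  ext ℓ i j
  by_cases hℓ : ℓ = k
  · subst hℓ; simp [perturb]
  · simp [perturb, hℓ]

/-- Integrating out one layer of the weights and of their perturbation. -/
theorem lintegral_weightLaw_le (s : ℝ≥0) (k : Fin L)
    {F G : Weights d N L × Weights d N L → ℝ≥0∞} (hF : Measurable F)
    (h : ∀ A B, ∫⁻ b, ∫⁻ c, F (Function.update A k b, Function.update B k c)
        ∂(layerLaw (layerDim d N L (k + 1)) (layerDim d N L k) s)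
        ∂(layerLaw (layerDim d N L (k + 1)) (layerDim d N L k) 1) ≤ G (A, B)) :
    ∫⁻ A, ∫⁻ B, F (A, B) ∂(weightLaw d N L s) ∂(weightLaw d N L 1) ≤
      ∫⁻ A, ∫⁻ B, G (A, B) ∂(weightLaw d N L s) ∂(weightLaw d N L 1) := by
  have hu := measurable_update_uncurry (α := fun ℓ : Fin L =>
    Fin (layerDim d N L (ℓ + 1)) → Fin (layerDim d N L ℓ) → ℝ) k
  have e1 : ∫⁻ A, ∫⁻ B, F (A, B) ∂(weightLaw d N L s) ∂(weightLaw d N L 1) =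
      ∫⁻ A, ∫⁻ b, ∫⁻ B, F (Function.update A k b, B) ∂(weightLaw d N L s)
        ∂(layerLaw (layerDim d N L (k + 1)) (layerDim d N L k) 1) ∂(weightLaw d N L 1) :=
    lintegral_pi_update _ k hF.lintegral_prod_right'
  rw [e1]
  refine lintegral_mono fun A => ?_
  have e2 : ∀ b, ∫⁻ B, F (Function.update A k b, B) ∂(weightLaw d N L s) =
      ∫⁻ B, ∫⁻ c, F (Function.update A k b, Function.update B k c)
        ∂(layerLaw (layerDim d N L (k + 1)) (layerDim d N L k) s) ∂(weightLaw d N L s) :=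
    fun b => lintegral_pi_update _ k (F := fun B => F (Function.update A k b, B)) (by fun_prop)
  simp_rw [e2]
  have hAb : Measurable fun b => Function.update A k b :=
    hu.comp (f := fun b => (A, b)) (by fun_prop)
  -- The fresh layer `b` has to be integrated inside the remaining perturbation `B`, so that `h`
  -- applies with `A` and `B` frozen.
  rw [lintegral_lintegral_swap]
  · exact lintegral_mono fun B => h A B
  · refine Measurable.aemeasurable ?_
    refine Measurable.lintegral_prod_right' (f := fun p : ((Fin (layerDim d N L (k + 1)) →
      Fin (layerDim d N L k) → ℝ) × Weights d N L) × (Fin (layerDim d N L (k + 1)) →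
      Fin (layerDim d N L k) → ℝ) => F (Function.update A k p.1.1,
        Function.update p.1.2 k p.2)) ?_
    refine hF.comp (Measurable.prodMk (hAb.comp (by fun_prop)) ?_)
    exact hu.comp (f := fun p : ((Fin (layerDim d N L (k + 1)) →
      Fin (layerDim d N L k) → ℝ) × Weights d N L) × (Fin (layerDim d N L (k + 1)) →
      Fin (layerDim d N L k) → ℝ) => (p.1.2, p.2)) (by fun_prop)

theorem relu_sq_le (a : ℝ) : (max 0 a) ^ 2 ≤ a ^ 2 := by
  rcases le_total 0 a with h | h <;> simp [h, sq_nonneg]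

theorem relu_sub_sq_le (a b : ℝ) : (max 0 a - max 0 b) ^ 2 ≤ (a - b) ^ 2 := by
  rw [sq_le_sq, max_comm 0 a, max_comm 0 b]
  exact abs_max_sub_max_le_abs a b 0

/-- A layer with weights `b` (resp. `r b + c`) applied to a vector, on the level of second
moments. -/
theorem layer_moments (m n : ℕ) {r : ℝ} {s : ℝ≥0} (hr0 : 0 ≤ r) (hrs : r ^ 2 + s = 1)
    (U V : Fin n → ℝ) :
    ∫⁻ b, ∫⁻ _, ENNReal.ofReal (∑ i, (max 0 (∑ j, b i j * U j)) ^ 2)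
      ∂(layerLaw m n s) ∂(layerLaw m n 1) ≤
        ENNReal.ofReal (m * ((n : ℝ)⁻¹ * ∑ j, U j ^ 2)) ∧
    ∫⁻ b, ∫⁻ c, ENNReal.ofReal (∑ i, (max 0 (∑ j, (r * b i j + c i j) * V j)) ^ 2)
      ∂(layerLaw m n s) ∂(layerLaw m n 1) ≤
        ENNReal.ofReal (m * ((n : ℝ)⁻¹ * ∑ j, V j ^ 2)) ∧
    ∫⁻ b, ∫⁻ c, ENNReal.ofReal (∑ i, (max 0 (∑ j, b i j * U j) -
        max 0 (∑ j, (r * b i j + c i j) * V j)) ^ 2)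
      ∂(layerLaw m n s) ∂(layerLaw m n 1) ≤
        ENNReal.ofReal (m * ((n : ℝ)⁻¹ * (∑ j, (U j - V j) ^ 2 +
          s * ∑ j, U j ^ 2 + s * ∑ j, V j ^ 2))) := by
  have hs0 : (0 : ℝ) ≤ s := s.2
  have hr1 : r ≤ 1 := by nlinarith
  refine ⟨?_, ?_, ?_⟩
  · have := lintegral_layerLaw_sq m n s U 0
    simp only [Pi.zero_apply, mul_zero, Finset.sum_const_zero, add_zero, ne_eq, OfNat.ofNat_ne_zero,
      not_false_eq_true, zero_pow] at this
    rw [← this]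
    exact lintegral_mono fun _ => lintegral_mono fun _ => ENNReal.ofReal_le_ofReal
      (Finset.sum_le_sum fun i _ => relu_sq_le _)
  · have := lintegral_layerLaw_sq m n s (fun j => r * V j) V
    -- Here r² + s = 1 enters: shrinking and adding noise leave the second moment unchanged.
    have e : ∑ j, (r * V j) ^ 2 + s * ∑ j, V j ^ 2 = ∑ j, V j ^ 2 := by
      simp_rw [mul_pow]
      rw [← Finset.mul_sum, ← add_mul, hrs, one_mul]
    rw [e] at this
    rw [← this]
    refine lintegral_mono fun _ => lintegral_mono fun _ => ENNReal.ofReal_le_ofReal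
      (Finset.sum_le_sum fun i _ => (relu_sq_le _).trans (le_of_eq ?_))
    rw [← Finset.sum_add_distrib]
    congr 1
    exact Finset.sum_congr rfl fun j _ => by ring
  · have := lintegral_layerLaw_sq m n s (fun j => r * V j - U j) V
    refine le_trans ?_ (this.le.trans ?_)
    · refine lintegral_mono fun _ => lintegral_mono fun _ => ENNReal.ofReal_le_ofReal
        (Finset.sum_le_sum fun i _ => (relu_sub_sq_le _ _).trans (le_of_eq ?_))
      rw [← Finset.sum_add_distrib, ← Finset.sum_sub_distrib, ← neg_sq, ← Finset.sum_neg_distrib]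
      congr 1
      exact Finset.sum_congr rfl fun j _ => by ring
    · refine ENNReal.ofReal_le_ofReal (mul_le_mul_of_nonneg_left (mul_le_mul_of_nonneg_left
        (add_le_add_left ?_ _) (by positivity)) (by positivity))
      rw [Finset.mul_sum, ← Finset.sum_add_distrib]
      refine Finset.sum_le_sum fun j _ => ?_
      -- With s = 1 - r², the right side minus the left side is (1 - r)((U - V)² + r(U² + V²)),
      -- which is nonnegative for 0 ≤ r ≤ 1.
      nlinarith [mul_nonneg (mul_nonneg hr0 (sub_nonneg.2 hr1)) (sq_nonneg (V j)),
        mul_nonneg (sub_nonneg.2 hr1) (sq_nonneg (U j - V j)), sq_nonneg (U j),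
        mul_nonneg (mul_nonneg hr0 (sub_nonneg.2 hr1)) (sq_nonneg (U j))]

theorem layerDim_pos (hd : 1 ≤ d) (hN : 1 ≤ N) (ℓ : ℕ) : 0 < layerDim d N L ℓ := by
  cases ℓ with
  | zero => exact hd
  | succ ℓ => simp only [layerDim]; split_ifs <;> omega

theorem lintegral_lintegral_const_mul {α β : Type*} [MeasurableSpace α] [MeasurableSpace β]
    {μ : Measure α} {ν : Measure β} [SFinite ν] (c : ℝ≥0∞) {f : α × β → ℝ≥0∞}
    (hf : Measurable f) :
    ∫⁻ a, ∫⁻ b, c * f (a, b) ∂ν ∂μ = c * ∫⁻ a, ∫⁻ b, f (a, b) ∂ν ∂μ := by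
  have : ∀ a, ∫⁻ b, c * f (a, b) ∂ν = c * ∫⁻ b, f (a, b) ∂ν := fun a =>
    lintegral_const_mul _ (by fun_prop)
  simp_rw [this]
  exact lintegral_const_mul _ hf.lintegral_prod_right'

theorem lintegral_lintegral_linear_comb {α β : Type*} [MeasurableSpace α] [MeasurableSpace β]
    {μ : Measure α} {ν : Measure β} [SFinite ν] (c s : ℝ≥0∞) {f g h : α × β → ℝ≥0∞}
    (hf : Measurable f) (hg : Measurable g) (hh : Measurable h) :
    ∫⁻ a, ∫⁻ b, c * (f (a, b) + s * g (a, b) + s * h (a, b)) ∂ν ∂μ =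
      c * (∫⁻ a, ∫⁻ b, f (a, b) ∂ν ∂μ + s * ∫⁻ a, ∫⁻ b, g (a, b) ∂ν ∂μ +
        s * ∫⁻ a, ∫⁻ b, h (a, b) ∂ν ∂μ) := by
  rw [lintegral_lintegral_const_mul c (f := fun p => f p + s * g p + s * h p) (by fun_prop),
    ← lintegral_lintegral_const_mul s hg, ← lintegral_lintegral_const_mul s hh]
  have e : ∀ a, ∫⁻ b, (f (a, b) + s * g (a, b) + s * h (a, b)) ∂ν =
      ∫⁻ b, f (a, b) ∂ν + ∫⁻ b, s * g (a, b) ∂ν + ∫⁻ b, s * h (a, b) ∂ν := fun a => by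
    rw [lintegral_add_left (by fun_prop), lintegral_add_left (by fun_prop)]
  have hf' := hf.lintegral_prod_right' (ν := ν)
  have hg' := (hg.const_mul s).lintegral_prod_right' (ν := ν)
  simp_rw [e]
  rw [lintegral_add_left (show Measurable fun a => ∫⁻ b, f (a, b) ∂ν + ∫⁻ b, s * g (a, b) ∂ν from
    hf'.add hg'), lintegral_add_left hf']

/-- Second moments of the layer outputs of a network and of its perturbation, and of their
difference. -/
theorem network_moments (hd : 1 ≤ d) (hN : 1 ≤ N) {r : ℝ} {s : ℝ≥0} (hr0 : 0 ≤ r)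
    (hrs : r ^ 2 + s = 1) (x : Fin d → ℝ) (ℓ : ℕ) (h : ℓ ≤ L) :
    ∫⁻ A, ∫⁻ _, ENNReal.ofReal (∑ i, layerOutput A x ℓ h i ^ 2)
      ∂(weightLaw d N L s) ∂(weightLaw d N L 1) ≤
        ENNReal.ofReal (layerDim d N L ℓ * ((∑ j, x j ^ 2) / d)) ∧
    ∫⁻ A, ∫⁻ B, ENNReal.ofReal (∑ i, layerOutput (perturb r (A, B)) x ℓ h i ^ 2)
      ∂(weightLaw d N L s) ∂(weightLaw d N L 1) ≤
        ENNReal.ofReal (layerDim d N L ℓ * ((∑ j, x j ^ 2) / d)) ∧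
    ∫⁻ A, ∫⁻ B, ENNReal.ofReal (∑ i, (layerOutput A x ℓ h i -
        layerOutput (perturb r (A, B)) x ℓ h i) ^ 2)
      ∂(weightLaw d N L s) ∂(weightLaw d N L 1) ≤
        ENNReal.ofReal (2 * s * ℓ * (layerDim d N L ℓ * ((∑ j, x j ^ 2) / d))) := by
  induction ℓ with
  | zero =>
    have hd' : (d : ℝ) ≠ 0 := by positivity
    have e : ((layerDim d N L 0 : ℕ) : ℝ) * ((∑ j, x j ^ 2) / d) = ∑ j, x j ^ 2 := by
      simp only [layerDim]
      field_simp
    rw [e]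
    simp only [layerOutput, lintegral_const, measure_univ, mul_one, sub_self]
    refine ⟨le_rfl, le_rfl, ?_⟩
    simp
  | succ ℓ ih =>
    have h' := Nat.le_of_succ_le h
    obtain ⟨ihU, ihV, ihD⟩ := ih h'
    set K : ℝ := (∑ j, x j ^ 2) / d with hK
    have hK0 : 0 ≤ K := by positivity
    have hs0 : (0 : ℝ) ≤ s := s.2
    have hmO : ∀ (k : ℕ) (hk : k ≤ L), Measurable fun A : Weights d N L => layerOutput A x k hk :=
      fun k hk => (measurable_layerOutput k hk).comp (f := fun A => (A, x)) (by fun_prop)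
    have hmU : ∀ (k : ℕ) (hk : k ≤ L) i, Measurable fun p : Weights d N L × Weights d N L =>
        layerOutput p.1 x k hk i := fun k hk i =>
      (measurable_pi_apply i).comp ((hmO k hk).comp measurable_fst)
    have hmV : ∀ (k : ℕ) (hk : k ≤ L) i, Measurable fun p : Weights d N L × Weights d N L =>
        layerOutput (perturb r p) x k hk i := fun k hk i =>
      (measurable_pi_apply i).comp ((hmO k hk).comp (measurable_perturb r))
    set n := layerDim d N L ℓ with hn
    set m := layerDim d N L (ℓ + 1) with hm
    have hn0 : (n : ℝ) ≠ 0 := by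
      have := layerDim_pos (L := L) hd hN ℓ
      positivity
    have hmul : ∀ t : ℝ, ENNReal.ofReal (m * ((n : ℝ)⁻¹ * t)) =
        ENNReal.ofReal (m * (n : ℝ)⁻¹) * ENNReal.ofReal t := fun t => by
      rw [← ENNReal.ofReal_mul (by positivity), mul_assoc]
    have hUU : Measurable fun p : Weights d N L × Weights d N L =>
        ENNReal.ofReal (∑ j, layerOutput p.1 x ℓ h' j ^ 2) := by
      have := hmU ℓ h'
      fun_prop
    have hVV : Measurable fun p : Weights d N L × Weights d N L =>
        ENNReal.ofReal (∑ j, layerOutput (perturb r p) x ℓ h' j ^ 2) := by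
      have := hmV ℓ h'
      fun_prop
    have hDD : Measurable fun p : Weights d N L × Weights d N L =>
        ENNReal.ofReal (∑ j, (layerOutput p.1 x ℓ h' j - layerOutput (perturb r p) x ℓ h' j) ^ 2) := by
      have := hmU ℓ h'
      have := hmV ℓ h'
      fun_prop
    refine ⟨?_, ?_, ?_⟩
    · refine (lintegral_weightLaw_le s ⟨ℓ, h⟩
        (F := fun p => ENNReal.ofReal (∑ i, layerOutput p.1 x (ℓ + 1) h i ^ 2))
        (G := fun p => ENNReal.ofReal (m * (n : ℝ)⁻¹) *
          ENNReal.ofReal (∑ j, layerOutput p.1 x ℓ h' j ^ 2)) ?_ fun A B => ?_).trans ?_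
      · have := hmU (ℓ + 1) h
        fun_prop
      · simp only [layerOutput_succ_update]
        rw [← hmul]
        exact (layer_moments m n hr0 hrs _ (layerOutput (perturb r (A, B)) x ℓ h')).1
      · rw [lintegral_lintegral_const_mul _ hUU]
        refine (mul_le_mul_right ihU _).trans (le_of_eq ?_)
        rw [← hmul]
        congr 1
        simp only [← hn, ← hm]
        field_simp
    · refine (lintegral_weightLaw_le s ⟨ℓ, h⟩
        (F := fun p => ENNReal.ofReal (∑ i, layerOutput (perturb r p) x (ℓ + 1) h i ^ 2))
        (G := fun p => ENNReal.ofReal (m * (n : ℝ)⁻¹) *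
          ENNReal.ofReal (∑ j, layerOutput (perturb r p) x ℓ h' j ^ 2)) ?_ fun A B => ?_).trans ?_
      · have := hmV (ℓ + 1) h
        fun_prop
      · simp only [perturb_update, layerOutput_succ_update]
        rw [← hmul]
        exact (layer_moments m n hr0 hrs (layerOutput A x ℓ h') _).2.1
      · rw [lintegral_lintegral_const_mul _ hVV]
        refine (mul_le_mul_right ihV _).trans (le_of_eq ?_)
        rw [← hmul]
        congr 1
        simp only [← hn, ← hm]
        field_simp
    · refine (lintegral_weightLaw_le s ⟨ℓ, h⟩
        (F := fun p => ENNReal.ofReal (∑ i, (layerOutput p.1 x (ℓ + 1) h i -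
          layerOutput (perturb r p) x (ℓ + 1) h i) ^ 2))
        (G := fun p => ENNReal.ofReal (m * (n : ℝ)⁻¹) *
          (ENNReal.ofReal (∑ j, (layerOutput p.1 x ℓ h' j -
            layerOutput (perturb r p) x ℓ h' j) ^ 2) +
          ENNReal.ofReal s * ENNReal.ofReal (∑ j, layerOutput p.1 x ℓ h' j ^ 2) +
          ENNReal.ofReal s * ENNReal.ofReal (∑ j, layerOutput (perturb r p) x ℓ h' j ^ 2)))
        ?_ fun A B => ?_).trans ?_
      · have := hmU (ℓ + 1) h
        have := hmV (ℓ + 1) h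
        fun_prop
      · simp only [perturb_update, layerOutput_succ_update]
        rw [← ENNReal.ofReal_mul hs0, ← ENNReal.ofReal_mul hs0,
          ← ENNReal.ofReal_add (by positivity) (by positivity),
          ← ENNReal.ofReal_add (by positivity) (by positivity), ← hmul]
        exact (layer_moments m n hr0 hrs _ _).2.2
      -- Relative to n K, the old error is at most 2sℓ and the two second moments add at most s
      -- each, giving 2s(ℓ + 1). The factor m/n then turns n K into m K.
      · refine (lintegral_lintegral_linear_comb _ _ hDD hUU hVV).le.trans ?_
        refine (mul_le_mul_right (add_le_add (add_le_add ihD (mul_le_mul_right ihU _))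
          (mul_le_mul_right ihV _)) _).trans (le_of_eq ?_)
        rw [← ENNReal.ofReal_mul hs0,
          ← ENNReal.ofReal_add (by positivity) (by positivity),
          ← ENNReal.ofReal_add (by positivity) (by positivity), ← hmul]
        congr 1
        simp only [← hn, ← hm]
        push_cast
        field_simp
        ring

end Network

/-! ### Change of measure from the prior to perturbed weights -/

section ChangeOfMeasure

/-- Changes of measure tensorise, with additive costs. This is applied three times, to layers, rows
and entries, to reduce the weights to one scalar Gaussian. -/
theorem pi_eq_map_withDensity {ι : Type*} [Fintype ι] {α β : ι → Type*}
    [∀ i, MeasurableSpace (α i)] [∀ i, MeasurableSpace (β i)]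
    {μ : ∀ i, Measure (β i)} {ν : ∀ i, Measure (α i)} [∀ i, IsProbabilityMeasure (μ i)]
    [∀ i, IsProbabilityMeasure (ν i)] {q : ∀ i, α i → ℝ} {g : ∀ i, α i → β i}
    (hq : ∀ i, Measurable (q i)) (hg : ∀ i, Measurable (g i))
    (h : ∀ i, μ i = ((ν i).withDensity fun x => ENNReal.ofReal (Real.exp (-q i x))).map (g i)) :
    Measure.pi μ = ((Measure.pi ν).withDensity fun x =>
      ENNReal.ofReal (Real.exp (-∑ i, q i (x i)))).map fun x i => g i (x i) := by
  -- The reweighted measure has the same total mass as its image, which is a probability measure.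
  have hfin : ∀ i, IsFiniteMeasure
      ((ν i).withDensity fun x => ENNReal.ofReal (Real.exp (-q i x))) := fun i => by
    constructor
    have : ((ν i).withDensity fun x => ENNReal.ofReal (Real.exp (-q i x))) Set.univ =
        μ i Set.univ := by
      conv_rhs => rw [h i]
      rw [Measure.map_apply (hg i) .univ, Set.preimage_univ]
    rw [this]
    exact measure_lt_top _ _
  have e : ∀ x : ∀ i, α i, ENNReal.ofReal (Real.exp (-∑ i, q i (x i))) =
      ∏ i, ENNReal.ofReal (Real.exp (-q i (x i))) := fun x => by
    rw [← Finset.sum_neg_distrib, Real.exp_sum,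
      ENNReal.ofReal_prod_of_nonneg fun _ _ => (Real.exp_pos _).le]
  simp_rw [e]
  rw [← pi_withDensity ν (f := fun i x => ENNReal.ofReal (Real.exp (-q i x)))
    fun i => by have := hq i; fun_prop]
  have hsf : ∀ i, SigmaFinite
      (((ν i).withDensity fun x => ENNReal.ofReal (Real.exp (-q i x))).map (g i)) := fun i => by
    rw [← h i]; infer_instance
  rw [Measure.pi_map_pi fun i => (hg i).aemeasurable]
  congr 1
  exact funext h

/-- Minus the logarithm of the density that transforms the perturbed value of an entry into a
sample of the prior. -/
def entryCost (c s r a e : ℝ) : ℝ :=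
  -(Real.log s / 2) + (r * a + e) ^ 2 / (2 * c) - e ^ 2 / (2 * (s * c))

/-- The cost is chosen so that the reweighted noise has law 𝒩(-r a, c); adding r a then recentres it
to the prior, whatever the value of `a`. -/
theorem gaussianReal_eq_map_withDensity {c s : ℝ≥0} (hc : c ≠ 0) (hs : s ≠ 0) (r a : ℝ) :
    gaussianReal 0 c = ((gaussianReal 0 (s * c)).withDensity fun e =>
      ENNReal.ofReal (Real.exp (-entryCost c s r a e))).map fun e => r * a + e := by
  have hsc : s * c ≠ 0 := mul_ne_zero hs hc
  have hc' : (0 : ℝ) < c := by positivity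
  have hs' : (0 : ℝ) < s := by positivity
  have hlog : Real.log √(2 * Real.pi * (s * c)) =
      Real.log s / 2 + Real.log √(2 * Real.pi * c) := by
    have hpc : 0 < 2 * Real.pi * (c : ℝ) := by positivity
    rw [show 2 * Real.pi * ((s : ℝ) * c) = s * (2 * Real.pi * c) by ring,
      Real.log_sqrt (by positivity), Real.log_sqrt hpc.le, Real.log_mul hs'.ne' hpc.ne']
    ring
  rw [gaussianReal_of_var_ne_zero 0 hsc, ← withDensity_mul _ (measurable_gaussianPDF _ _)
    (by unfold entryCost; fun_prop)]
  have e : (gaussianPDF 0 (s * c) * fun e => ENNReal.ofReal (Real.exp (-entryCost c s r a e))) =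
      gaussianPDF (-(r * a)) c := by
    ext e
    rw [Pi.mul_apply, gaussianPDF_eq_exp _ hsc, gaussianPDF_eq_exp _ hc,
      ← ENNReal.ofReal_mul (Real.exp_pos _).le, ← Real.exp_add]
    congr 2
    push_cast
    rw [hlog, entryCost]
    ring
  rw [e, ← gaussianReal_of_var_ne_zero _ hc, gaussianReal_map_const_add, neg_add_cancel]

/-- Since r² + s = 1, both r a + e (variance c) and e (variance s c) have normalised second moment
1, so the two quadratic terms cancel on average. What remains is the mutual information between a
and r a + e. -/
theorem entryCost_integrable {c s : ℝ≥0} (hc : c ≠ 0) (hs : s ≠ 0) {r : ℝ}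
    (hrs : r ^ 2 + s = 1) :
    Integrable (fun p : ℝ × ℝ => entryCost c s r p.1 p.2)
      ((gaussianReal 0 c).prod (gaussianReal 0 (s * c))) ∧
    ∫ p : ℝ × ℝ, entryCost c s r p.1 p.2 ∂((gaussianReal 0 c).prod (gaussianReal 0 (s * c))) =
      -(Real.log s / 2) := by
  set M := (gaussianReal 0 c).prod (gaussianReal 0 (s * c)) with hM
  have hc' : (c : ℝ) ≠ 0 := by exact_mod_cast hc
  have hs' : (s : ℝ) ≠ 0 := by exact_mod_cast hs
  have h1 : MemLp (fun p : ℝ × ℝ => p.1) 2 M :=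
    (memLp_id_gaussianReal' 2 (by simp)).comp_measurePreserving measurePreserving_fst
  have h2 : MemLp (fun p : ℝ × ℝ => p.2) 2 M :=
    (memLp_id_gaussianReal' 2 (by simp)).comp_measurePreserving measurePreserving_snd
  have i1 : Integrable (fun p : ℝ × ℝ => p.1 ^ 2) M := h1.integrable_sq
  have i2 : Integrable (fun p : ℝ × ℝ => p.2 ^ 2) M := h2.integrable_sq
  have i3 : Integrable (fun p : ℝ × ℝ => p.1 * p.2) M := h1.integrable_mul h2
  have v1 : ∫ p : ℝ × ℝ, p.1 ^ 2 ∂M = c := by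
    rw [hM, integral_fun_fst (fun x : ℝ => x ^ 2), integral_gaussian_sq]; simp
  have v2 : ∫ p : ℝ × ℝ, p.2 ^ 2 ∂M = s * c := by
    rw [hM, integral_fun_snd (fun x : ℝ => x ^ 2), integral_gaussian_sq]; simp
  have v3 : ∫ p : ℝ × ℝ, p.1 * p.2 ∂M = 0 := by
    rw [hM, integral_prod_mul (fun x : ℝ => x) (fun x : ℝ => x)]; simp
  have e : (fun p : ℝ × ℝ => entryCost c s r p.1 p.2) = fun p =>
      (-(Real.log s / 2) + (r ^ 2 / (2 * c)) * p.1 ^ 2) + ((r / c) * (p.1 * p.2) +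
        (1 / (2 * c) - 1 / (2 * (s * c))) * p.2 ^ 2) := by
    ext p
    simp only [entryCost]
    field_simp
    ring
  have j1 : Integrable (fun p : ℝ × ℝ => -(Real.log s / 2) + (r ^ 2 / (2 * c)) * p.1 ^ 2) M :=
    (integrable_const _).add (i1.const_mul _)
  have j2 : Integrable (fun p : ℝ × ℝ => (r / c) * (p.1 * p.2) +
      (1 / (2 * c) - 1 / (2 * (s * c))) * p.2 ^ 2) M := (i3.const_mul _).add (i2.const_mul _)
  rw [e]
  refine ⟨j1.add j2, ?_⟩
  rw [integral_add j1 j2, integral_add (integrable_const _) (i1.const_mul _),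
    integral_add (i3.const_mul _) (i2.const_mul _), integral_const_mul, integral_const_mul,
    integral_const_mul, v1, v2, v3]
  simp only [integral_const, probReal_univ, one_smul]
  have hr : r ^ 2 = 1 - s := by linarith
  rw [hr]
  field_simp
  ring

variable {d N L : ℕ}

/-- The total cost of all entries. -/
def weightCost (s r : ℝ) (p : Weights d N L × Weights d N L) : ℝ :=
  ∑ ℓ : Fin L, ∑ i, ∑ j,
    entryCost ((layerDim d N L ℓ : ℝ≥0)⁻¹ : ℝ≥0) s r (p.1 ℓ i j) (p.2 ℓ i j)

theorem measurable_weightCost (s r : ℝ) :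
    Measurable (weightCost (d := d) (N := N) (L := L) s r) := by
  unfold weightCost entryCost
  fun_prop

theorem inv_layerDim_ne_zero (hd : 1 ≤ d) (hN : 1 ≤ N) (ℓ : ℕ) :
    ((layerDim d N L ℓ : ℝ≥0)⁻¹ : ℝ≥0) ≠ 0 := by
  have := layerDim_pos (L := L) hd hN ℓ
  positivity

theorem weightLaw_eq_map_withDensity (hd : 1 ≤ d) (hN : 1 ≤ N) {s : ℝ≥0} (hs : s ≠ 0) (r : ℝ)
    (A : Weights d N L) :
    weightLaw d N L 1 = ((weightLaw d N L s).withDensity fun B =>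
      ENNReal.ofReal (Real.exp (-weightCost s r (A, B)))).map fun B => perturb r (A, B) := by
  refine pi_eq_map_withDensity (q := fun (ℓ : Fin L)
      (B : Fin (layerDim d N L (ℓ + 1)) → Fin (layerDim d N L ℓ) → ℝ) => ∑ i, ∑ j,
      entryCost ((layerDim d N L ℓ : ℝ≥0)⁻¹ : ℝ≥0) s r (A ℓ i j) (B i j))
    (g := fun (ℓ : Fin L)
      (B : Fin (layerDim d N L (ℓ + 1)) → Fin (layerDim d N L ℓ) → ℝ) i j => r * A ℓ i j + B i j)
    (fun ℓ => by unfold entryCost; fun_prop) (fun ℓ => by fun_prop) fun ℓ => ?_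
  refine pi_eq_map_withDensity (q := fun (i : Fin (layerDim d N L (ℓ + 1)))
      (B : Fin (layerDim d N L ℓ) → ℝ) => ∑ j,
      entryCost ((layerDim d N L ℓ : ℝ≥0)⁻¹ : ℝ≥0) s r (A ℓ i j) (B j))
    (g := fun (i : Fin (layerDim d N L (ℓ + 1))) (B : Fin (layerDim d N L ℓ) → ℝ) j => r * A ℓ i j + B j)
    (fun i => by unfold entryCost; fun_prop) (fun i => by fun_prop) fun i => ?_
  refine pi_eq_map_withDensity (q := fun j e =>
      entryCost ((layerDim d N L ℓ : ℝ≥0)⁻¹ : ℝ≥0) s r (A ℓ i j) e)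
    (g := fun j e => r * A ℓ i j + e)
    (fun j => by unfold entryCost; fun_prop) (fun j => by fun_prop) fun j => ?_
  rw [one_mul]
  exact gaussianReal_eq_map_withDensity (inv_layerDim_ne_zero hd hN ℓ) hs r _

theorem measurePreserving_entry (s : ℝ≥0) (ℓ : Fin L) (i : Fin (layerDim d N L (ℓ + 1)))
    (j : Fin (layerDim d N L ℓ)) :
    MeasurePreserving (fun A : Weights d N L => A ℓ i j) (weightLaw d N L s)
      (gaussianReal 0 (s * (layerDim d N L ℓ : ℝ≥0)⁻¹)) :=
  (measurePreserving_eval _ j).comp ((measurePreserving_eval _ i).comp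
    (measurePreserving_eval (fun ℓ : Fin L =>
      layerLaw (layerDim d N L (ℓ + 1)) (layerDim d N L ℓ) s) ℓ))

theorem sum_layerDim (hL : 1 ≤ L) (hLN : L = 1 → N = 1) :
    ∑ ℓ : Fin L, (layerDim d N L (ℓ + 1) : ℝ) * layerDim d N L ℓ = paramCount d N L := by
  rw [Fin.sum_univ_eq_sum_range fun ℓ => (layerDim d N L (ℓ + 1) : ℝ) * layerDim d N L ℓ]
  obtain rfl | hL2 := hL.eq_or_lt
  -- For L = 1 the formula reads -N² + N + dN, which equals the true count d because N = 1.
  · simp [layerDim, paramCount, hLN rfl]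
    norm_num
  · obtain ⟨k, rfl⟩ : ∃ k, L = k + 2 := ⟨L - 2, by omega⟩
    rw [Finset.sum_range_succ, Finset.sum_range_succ']
    have : ∀ ℓ ∈ Finset.range k, (layerDim d N (k + 2) (ℓ + 1 + 1) : ℝ) *
        layerDim d N (k + 2) (ℓ + 1) = (N : ℝ) ^ 2 := fun ℓ hℓ => by
      have := Finset.mem_range.1 hℓ
      simp only [layerDim]
      rw [if_neg (by omega), if_neg (by omega), sq]
    rw [Finset.sum_congr rfl this]
    simp [layerDim, paramCount]
    ring

/-- The mean cost of an entry does not depend on its layer's variance, so the total is the number of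
entries times -(ln s)/2. -/
theorem weightCost_integrable (hd : 1 ≤ d) (hN : 1 ≤ N) (hL : 1 ≤ L) (hLN : L = 1 → N = 1)
    {s : ℝ≥0} (hs : s ≠ 0) {r : ℝ} (hrs : r ^ 2 + s = 1) :
    Integrable (weightCost (d := d) (N := N) (L := L) s r)
      ((weightLaw d N L 1).prod (weightLaw d N L s)) ∧
    ∫ p, weightCost (d := d) (N := N) (L := L) s r p
      ∂((weightLaw d N L 1).prod (weightLaw d N L s)) =
        paramCount d N L * -(Real.log s / 2) := by
  have key : ∀ (ℓ : Fin L) (i : Fin (layerDim d N L (ℓ + 1))) (j : Fin (layerDim d N L ℓ)),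
      Integrable (fun p : Weights d N L × Weights d N L =>
        entryCost ((layerDim d N L ℓ : ℝ≥0)⁻¹ : ℝ≥0) s r (p.1 ℓ i j) (p.2 ℓ i j))
        ((weightLaw d N L 1).prod (weightLaw d N L s)) ∧
      ∫ p : Weights d N L × Weights d N L,
        entryCost ((layerDim d N L ℓ : ℝ≥0)⁻¹ : ℝ≥0) s r (p.1 ℓ i j) (p.2 ℓ i j)
        ∂((weightLaw d N L 1).prod (weightLaw d N L s)) = -(Real.log s / 2) := by
    intro ℓ i j
    obtain ⟨h1, h2⟩ := entryCost_integrable (inv_layerDim_ne_zero (L := L) hd hN ℓ) hs hrs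
    have hmp := (measurePreserving_entry (d := d) (N := N) 1 ℓ i j).prod
      (measurePreserving_entry (d := d) (N := N) s ℓ i j)
    rw [one_mul] at hmp
    refine ⟨hmp.integrable_comp_of_integrable h1, ?_⟩
    rw [← h2, ← hmp.map_eq, integral_map hmp.measurable.aemeasurable]
    · rfl
    · rw [hmp.map_eq]; exact h1.aestronglyMeasurable
  refine ⟨integrable_finsetSum _ fun ℓ _ => integrable_finsetSum _ fun i _ =>
    integrable_finsetSum _ fun j _ => (key ℓ i j).1, ?_⟩
  unfold weightCost
  rw [integral_finsetSum _ fun ℓ _ => integrable_finsetSum _ fun i _ =>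
    integrable_finsetSum _ fun j _ => (key ℓ i j).1, ← sum_layerDim hL hLN, Finset.sum_mul]
  refine Finset.sum_congr rfl fun ℓ _ => ?_
  rw [integral_finsetSum _ fun i _ => integrable_finsetSum _ fun j _ => (key ℓ i j).1]
  have : ∀ i, ∫ p : Weights d N L × Weights d N L, ∑ j,
      entryCost ((layerDim d N L ℓ : ℝ≥0)⁻¹ : ℝ≥0) s r (p.1 ℓ i j) (p.2 ℓ i j)
      ∂((weightLaw d N L 1).prod (weightLaw d N L s)) =
        layerDim d N L ℓ * -(Real.log s / 2) := fun i => by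
    rw [integral_finsetSum _ fun j _ => (key ℓ i j).1,
      Finset.sum_congr rfl fun j _ => (key ℓ i j).2]
    simp
  rw [Finset.sum_congr rfl fun i _ => this i, Finset.sum_const, Finset.card_univ,
    Fintype.card_fin, nsmul_eq_mul, mul_assoc]

/-- The standard Gaussian input distribution. -/
def inputLaw (d : ℕ) : Measure (Fin d → ℝ) := Measure.pi fun _ => gaussianReal 0 1

instance : IsProbabilityMeasure (inputLaw d) := by
  unfold inputLaw; infer_instance

theorem lintegral_inputLaw_sq :
    ∫⁻ x, ENNReal.ofReal (∑ j, x j ^ 2) ∂(inputLaw d) = ENNReal.ofReal d := by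
  simp_rw [ENNReal.ofReal_sum_of_nonneg fun j _ => sq_nonneg _]
  rw [lintegral_finsetSum _ fun i _ => by fun_prop]
  have h : ∀ j, ∫⁻ x : Fin d → ℝ, ENNReal.ofReal (x j ^ 2) ∂(inputLaw d) = 1 := fun j => by
    rw [inputLaw, (measurePreserving_eval (fun _ : Fin d => gaussianReal 0 1) j).lintegral_comp
      (f := fun y => ENNReal.ofReal (y ^ 2)) (by fun_prop), ← ofReal_integral_eq_lintegral_ofReal
        (show Integrable (fun y : ℝ => y ^ 2) (gaussianReal 0 1) from
          (memLp_id_gaussianReal' 2 (by simp)).integrable_sq)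
        (Filter.Eventually.of_forall fun _ => sq_nonneg _)]
    simp [integral_gaussian_sq]
  rw [Finset.sum_congr rfl fun j _ => h j]
  simp

theorem measurable_networkOutput (hL : 1 ≤ L) :
    Measurable fun p : Weights d N L × (Fin d → ℝ) => networkOutput hL p.1 p.2 :=
  (measurable_pi_apply _).comp (measurable_layerOutput L le_rfl)

/-- The mean squared change of the network output under the perturbation of the weights. -/
theorem network_distortion (hd : 1 ≤ d) (hN : 1 ≤ N) (hL : 1 ≤ L) {r : ℝ} {s : ℝ≥0} (hr0 : 0 ≤ r)
    (hrs : r ^ 2 + s = 1) :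
    ∫⁻ p : (Weights d N L × (Fin d → ℝ)) × Weights d N L,
      ENNReal.ofReal ((networkOutput hL p.1.1 p.1.2 -
        networkOutput hL (perturb r (p.1.1, p.2)) p.1.2) ^ 2)
      ∂(((weightLaw d N L 1).prod (inputLaw d)).prod (weightLaw d N L s)) ≤
        ENNReal.ofReal (2 * s * L) := by
  have hF : Measurable fun p : (Weights d N L × (Fin d → ℝ)) × Weights d N L =>
      ENNReal.ofReal ((networkOutput hL p.1.1 p.1.2 -
        networkOutput hL (perturb r (p.1.1, p.2)) p.1.2) ^ 2) := by
    have h1 := measurable_networkOutput (d := d) (N := N) hL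
    have h2 := measurable_perturb (d := d) (N := N) (L := L) r
    refine (((h1.comp measurable_fst).sub (h1.comp (Measurable.prodMk (h2.comp ?_) ?_))).pow_const
      2).ennreal_ofReal <;> fun_prop
  -- The input becomes the outermost variable, since `network_moments` holds for each fixed `x`.
  rw [lintegral_prod _ hF.aemeasurable, lintegral_prod_symm' _ hF.lintegral_prod_right']
  have hd' : (d : ℝ) ≠ 0 := by positivity
  have hx : ∀ x : Fin d → ℝ, ∫⁻ A, ∫⁻ B, ENNReal.ofReal ((networkOutput hL A x -
        networkOutput hL (perturb r (A, B)) x) ^ 2) ∂(weightLaw d N L s) ∂(weightLaw d N L 1) ≤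
      ENNReal.ofReal (2 * s * L / d) * ENNReal.ofReal (∑ j, x j ^ 2) := fun x => by
    refine (lintegral_mono fun A => lintegral_mono fun B => ?_).trans
      ((network_moments hd hN hr0 hrs x L le_rfl).2.2.trans (le_of_eq ?_))
    · exact ENNReal.ofReal_le_ofReal (Finset.single_le_sum (f := fun i =>
        (layerOutput A x L le_rfl i - layerOutput (perturb r (A, B)) x L le_rfl i) ^ 2)
        (fun i _ => sq_nonneg _) (Finset.mem_univ _))
    · rw [← ENNReal.ofReal_mul (by positivity), layerDim_last d N hL]
      congr 1
      push_cast
      ring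
  refine (lintegral_mono hx).trans (le_of_eq ?_)
  rw [lintegral_const_mul _ (by fun_prop), lintegral_inputLaw_sq,
    ← ENNReal.ofReal_mul (by positivity)]
  congr 1
  field_simp

end ChangeOfMeasure

/-! ### The network process as a Gaussian regression -/

section DNN

variable {Ω : Type*} [MeasurableSpace Ω] {μ : Measure Ω} [IsProbabilityMeasure μ] {d N L : ℕ}
  {hL : 1 ≤ L} {v : ℝ≥0} {A : Ω → Weights d N L} {X : ℕ → Ω → (Fin d → ℝ)} {W Y : ℕ → Ω → ℝ}

/-- The two independence assumptions combine into a threefold product law. The maps `φ` and `ψ`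
select finitely many coordinates or a single one, as the fields of `IsGaussianRegression` require.
-/
theorem IsDNNProcess.map_joint (h : IsDNNProcess μ hL v A X W Y) {α β : Type*}
    [MeasurableSpace α] [MeasurableSpace β] {φ : (ℕ → Fin d → ℝ) → α} {ψ : (ℕ → ℝ) → β}
    (hφ : Measurable φ) (hψ : Measurable ψ) :
    μ.map (fun ω => ((A ω, φ fun t => X t ω), ψ fun t => W t ω)) =
      ((weightLaw d N L 1).prod (μ.map fun ω => φ fun t => X t ω)).prod
        (μ.map fun ω => ψ fun t => W t ω) := by
  have hA := h.measurable_weights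
  have hX : Measurable fun ω => φ fun t => X t ω :=
    hφ.comp (measurable_pi_lambda _ h.measurable_input)
  have hW : Measurable fun ω => ψ fun t => W t ω :=
    hψ.comp (measurable_pi_lambda _ h.measurable_noise)
  have h1 := (indepFun_iff_map_prod_eq_prod_map_map hX.aemeasurable hW.aemeasurable).1
    (h.indep_input_noise.comp hφ hψ)
  have h2 := (indepFun_iff_map_prod_eq_prod_map_map hA.aemeasurable (hX.prodMk hW).aemeasurable).1
    (h.indep_weights.comp measurable_id
      (ψ := fun p : (ℕ → Fin d → ℝ) × (ℕ → ℝ) => (φ p.1, ψ p.2)) (by fun_prop))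
  have : IsProbabilityMeasure (μ.map fun ω => φ fun t => X t ω) :=
    Measure.isProbabilityMeasure_map hX.aemeasurable
  have : IsProbabilityMeasure (μ.map fun ω => ψ fun t => W t ω) :=
    Measure.isProbabilityMeasure_map hW.aemeasurable
  rw [h1, h.law_weights, prior_eq_weightLaw] at h2
  have h3 := congrArg (Measure.map MeasurableEquiv.prodAssoc.symm) h2
  rw [(measurePreserving_prodAssoc _ _ _).symm.map_eq, Measure.map_map (by fun_prop)
    (hA.prodMk (hX.prodMk hW))] at h3
  exact h3

theorem IsDNNProcess.isGaussianRegression (h : IsDNNProcess μ hL v A X W Y) :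
    IsGaussianRegression μ (weightLaw d N L 1) (inputLaw d)
      (fun p => networkOutput hL p.1 p.2) v A X W Y where
  measurable_latent := h.measurable_weights
  measurable_input := h.measurable_input
  measurable_noise := h.measurable_noise
  measurable_fun := measurable_networkOutput hL
  label_eq := h.label_eq
  law_joint n m := by
    have key := h.map_joint (φ := fun x => fun s : Fin n => x s)
      (ψ := fun w => fun s : Fin m => w s) (by fun_prop) (by fun_prop)
    have hX := iIndepFun.map_fun_eq_pi_map (f := fun s : Fin n => X s)
      (fun s => (h.measurable_input s).aemeasurable) (h.indep_input.precomp Fin.val_injective)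
    have hW := iIndepFun.map_fun_eq_pi_map (f := fun s : Fin m => W s)
      (fun s => (h.measurable_noise s).aemeasurable) (h.indep_noise.precomp Fin.val_injective)
    beta_reduce at key
    rw [hX, hW] at key
    simp only [h.law_input, h.law_noise] at key
    exact key
  law_latent_input t := by
    have key := h.map_joint (φ := fun x => x t) (ψ := fun w => w t) (by fun_prop) (by fun_prop)
    have hm : Measurable fun ω => ((A ω, X t ω), W t ω) :=
      (h.measurable_weights.prodMk (h.measurable_input t)).prodMk (h.measurable_noise t)
    have h2 := congrArg (Measure.map Prod.fst) key
    have : IsProbabilityMeasure (μ.map fun ω => X t ω) :=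
      Measure.isProbabilityMeasure_map (h.measurable_input t).aemeasurable
    have : IsProbabilityMeasure (μ.map fun ω => W t ω) :=
      Measure.isProbabilityMeasure_map (h.measurable_noise t).aemeasurable
    rw [Measure.map_map measurable_fst hm, ← Measure.fst, Measure.fst_prod] at h2
    refine Eq.trans h2 ?_
    rw [show (fun ω => X t ω) = X t from rfl, h.law_input t, inputLaw]
  law_noise := h.law_noise
  indep_noise t := by
    have key := h.map_joint (φ := fun x => x t) (ψ := fun w => w t) (by fun_prop) (by fun_prop)
    have hAX := h.measurable_weights.prodMk (h.measurable_input t)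
    have : IsProbabilityMeasure (μ.map fun ω => X t ω) :=
      Measure.isProbabilityMeasure_map (h.measurable_input t).aemeasurable
    have : IsProbabilityMeasure (μ.map fun ω => W t ω) :=
      Measure.isProbabilityMeasure_map (h.measurable_noise t).aemeasurable
    have h2 := congrArg (Measure.map Prod.fst) key
    rw [Measure.map_map measurable_fst (hAX.prodMk (h.measurable_noise t)),
      ← Measure.fst, Measure.fst_prod] at h2
    rw [indepFun_iff_map_prod_eq_prod_map_map hAX.aemeasurable (h.measurable_noise t).aemeasurable]
    refine key.trans ?_
    rw [← h2]
    rfl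

/-- The term (L - 2)N² can be negative, so positivity is read off from the sum of layer sizes
instead of the closed formula. -/
theorem paramCount_pos (hd : 1 ≤ d) (hN : 1 ≤ N) (hL : 1 ≤ L) (hLN : L = 1 → N = 1) :
    0 < paramCount d N L := by
  rw [← sum_layerDim hL hLN]
  have : Nonempty (Fin L) := ⟨⟨0, hL⟩⟩
  refine Finset.sum_pos (fun ℓ _ => ?_) Finset.univ_nonempty
  have h1 := layerDim_pos (L := L) hd hN (ℓ + 1)
  have h2 := layerDim_pos (L := L) hd hN ℓ
  positivity

end DNN

end BayesDNN

end

/-! ### Choice of the noise level and conclusion -/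

theorem mainTheorem5 {Ω : Type*} [MeasurableSpace Ω] (μ : Measure Ω) [IsProbabilityMeasure μ]
    (d N L : ℕ) (hd : 1 ≤ d) (hN : 1 ≤ N) (hL : 1 ≤ L) (hLN : L = 1 → N = 1)
    (v : ℝ≥0) (hv : 0 < v)
    (A : Ω → BayesDNN.Weights d N L) (X : ℕ → Ω → (Fin d → ℝ)) (W Y : ℕ → Ω → ℝ)
    (hproc : BayesDNN.IsDNNProcess μ hL v A X W Y) (T : ℕ) (hT : 1 ≤ T) :
    (∀ t < T, BayesDNN.HasFiniteLogLoss μ (BayesDNN.history X Y t) (Y t)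
      (BayesDNN.posteriorPredictive μ X Y t)) ∧
    BayesDNN.HasFiniteLogLoss μ (BayesDNN.latentInputs A X T) (BayesDNN.labels Y T)
      (condDistrib (BayesDNN.labels Y T) (BayesDNN.latentInputs A X T) μ) ∧
    BayesDNN.estimationError μ A X Y T ≤
      BayesDNN.paramCount d N L / (2 * T) *
        (1 + Real.log (1 + 2 * L * T / (v * BayesDNN.paramCount d N L))) := by
  have hP := BayesDNN.paramCount_pos hd hN hL hLN
  set P := BayesDNN.paramCount d N L with hPdef
  have hv' : (0 : ℝ) < v := hv
  have hT' : (0 : ℝ) < T := by positivity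
  have hL' : (0 : ℝ) < L := by positivity
  -- The bound sL/v - (P/(2T)) ln s is minimised over s > 0 at s = 1/x. Taking s = 1/(1 + x) instead
  -- keeps s below 1, so that r = √(1 - s) satisfies r² + s = 1.
  set x : ℝ := 2 * L * T / (v * P) with hx
  have hx0 : 0 < x := by positivity
  set s : ℝ≥0 := ⟨(1 + x)⁻¹, by positivity⟩ with hs
  have hsv : (s : ℝ) = (1 + x)⁻¹ := rfl
  have hs0 : s ≠ 0 := by
    rw [← NNReal.coe_ne_zero, hsv]
    positivity
  have hs1 : (s : ℝ) ≤ 1 := by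
    rw [hsv]
    exact inv_le_one_of_one_le₀ (by linarith)
  have hrs : √(1 - (s : ℝ)) ^ 2 + s = 1 := by
    rw [Real.sq_sqrt (by linarith)]
    ring
  have hdist := BayesDNN.network_distortion hd hN hL (Real.sqrt_nonneg (1 - (s : ℝ))) hrs
  obtain ⟨hqi, hq⟩ := BayesDNN.weightCost_integrable hd hN hL hLN hs0 hrs
  have hmf := BayesDNN.measurable_networkOutput (d := d) (N := N) hL
  have hmp := BayesDNN.measurable_perturb (d := d) (N := N) (L := L) √(1 - (s : ℝ))
  have hDm : Measurable fun p : (BayesDNN.Weights d N L × (Fin d → ℝ)) × BayesDNN.Weights d N L =>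
      (BayesDNN.networkOutput hL p.1.1 p.1.2 - BayesDNN.networkOutput hL
        (BayesDNN.perturb √(1 - (s : ℝ)) (p.1.1, p.2)) p.1.2) ^ 2 := by
    refine ((hmf.comp measurable_fst).sub (hmf.comp (Measurable.prodMk (hmp.comp ?_) ?_))).pow_const
      2 <;> fun_prop
  -- The finite `∫⁻` bound on the distortion supplies the integrability needed to restate it as a
  -- Bochner integral.
  have hdi := (lintegral_ofReal_ne_top_iff_integrable hDm.aestronglyMeasurable
    (Filter.Eventually.of_forall fun _ => sq_nonneg _)).1
    (ne_top_of_le_ne_top ENNReal.ofReal_ne_top hdist)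
  rw [← ofReal_integral_eq_lintegral_ofReal hdi (Filter.Eventually.of_forall fun _ => sq_nonneg _),
    ENNReal.ofReal_le_ofReal_iff (by positivity)] at hdist
  obtain ⟨h1, h2, h3⟩ := hproc.isGaussianRegression.estimationError_le hv.ne' hmp
    (BayesDNN.measurable_weightCost s √(1 - (s : ℝ)))
    (BayesDNN.weightLaw_eq_map_withDensity hd hN hs0 _) hqi hdi T hT
  refine ⟨fun t _ => h1 t, h2, h3.trans ?_⟩
  rw [hq, hsv, Real.log_inv, ← hPdef]
  have hb := div_le_div_of_nonneg_right hdist (show (0 : ℝ) ≤ 2 * v by positivity)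
  -- The distortion term equals LP/(vP + 2LT); dropping vP from the denominator gives the summand 1
  -- in the final bound, while -ln s = ln(1 + x) gives the logarithm.
  have hc : 2 * (s : ℝ) * L / (2 * v) ≤ P / (2 * T) := by
    rw [hsv, hx]
    have e : 2 * (1 + 2 * L * T / (v * P))⁻¹ * L / (2 * v) = L * P / (v * P + 2 * L * T) := by
      field_simp
    rw [e, div_le_div_iff₀ (by positivity) (by positivity)]
    nlinarith [mul_pos hv' (mul_pos hP hP)]
  refine (add_le_add_left (hb.trans hc) _).trans (le_of_eq ?_)
  field_simp
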